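/- Let $\mathbb T$ be the unit circle with normalized Lebesgue measure $d\theta/2\pi$, let $I\subset\mathbb T$ be a union of finitely many (at least one) nonempty open arcs whose complement $J=\mathbb T\setminus I$ has nonempty interior, and let $f\in L^2(I)$. Let $H^2\subset L^2(\mathbb T)$ be the Hardy space of functions whose Fourier coefficients of negative index vanish. For $n\ge 0$ let $k_n$ be the solution of $PBEP(n)$: among complex polynomials $q$ of degree at most $n$ with $|q|\le 1$ a.e. on $J$, it minimizes $\|f-q\|_{L^2(I)}$. Let $g_0$ be the solution of $ABEP$: among $g\in H^2$ with $|g|\le 1$ a.e. on $J$, it minimizes $\|f-g\|_{L^2(I)}$. Then, as $n\to\infty$: (1) $\|g_0-k_n\|_{L^2(I)}\to 0$, and hence $\|g_0-k_n\|_{L^p(I)}\to 0$ for $1\le p\le 2$. (2) $k_n|_J\to g_0|_J$ weak-* in $L^\infty(J)$, i.e. $\frac1{2\pi}\int_J k_n\overline h\,d\theta\to\frac1{2\pi}\int_J g_0\overline h\,d\theta$ for every $h\in L^1(J)$. (3) If $f$ is not the trace on $I$ of an $H^2$ function of modulus at most $1$ a.e. on $J$ (equivalently, if $f\ne g_0$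 on $I$, i.e. the two do not agree a.e. on $I$), then $\|g_0-k_n\|_{L^p(J)}\to 0$ for every $1\le p<\infty$; in particular $\|g_0-k_n\|_{L^p(\mathbb T)}\to 0$ for $1\le p\le 2$. -/

import Mathlib

open MeasureTheory Filter Topology
open scoped ENNReal ComplexConjugate

/-- The unit circle, with the point `e^{iθ}` given by the class of `θ` modulo `2π`. -/
abbrev UCircle : Type := AddCircle (2 * Real.pi)

instance fact_zero_lt_two_pi : Fact ((0 : ℝ) < 2 * Real.pi) := ⟨Real.two_pi_pos⟩

/-- Lebesgue measure on the circle divided by `2π`: the measure behind all norms and pairings. -/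
noncomputable abbrev circleMeasure : Measure UCircle :=
  AddCircle.haarAddCircle

/-- `I` is the union of finitely many (and at least one) nonempty open arcs
`{e^{iθ} : a < θ < b}`, `a < b`. -/
def IsFiniteUnionOfOpenArcs (I : Set UCircle) : Prop :=
  ∃ s : Finset (ℝ × ℝ), s.Nonempty ∧ (∀ q ∈ s, q.1 < q.2) ∧
    I = ⋃ q ∈ s, (fun θ : ℝ => (θ : UCircle)) '' Set.Ioo q.1 q.2

/-- The norm of `L^p(E)`, `‖u‖ = (1/2π ∫_E |u(e^{iθ})|^p dθ)^{1/p}`, with value `∞` if `u` is not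
in `L^p(E)`. -/
noncomputable def normOn (p : ℝ≥0∞) (E : Set UCircle) (u : UCircle → ℂ) : ℝ≥0∞ :=
  eLpNorm u p (circleMeasure.restrict E)

/-- `u` represents an element of `L^p(E)`. -/
def MemLpOn (p : ℝ≥0∞) (E : Set UCircle) (u : UCircle → ℂ) : Prop :=
  MemLp u p (circleMeasure.restrict E)

/-- The pairing `⟨u, v⟩_E = 1/2π ∫_E u(e^{iθ}) conj (v(e^{iθ})) dθ`. -/
noncomputable def pairingOn (E : Set UCircle) (u v : UCircle → ℂ) : ℂ :=
  ∫ x in E, u x * conj (v x) ∂circleMeasure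

/-- `u` represents an element of the Hardy space `H^p`: it is in `L^p` of the circle and its Fourier
coefficients of strictly negative index vanish. -/
def MemHardy (p : ℝ≥0∞) (u : UCircle → ℂ) : Prop :=
  MemLp u p circleMeasure ∧
    ∀ n : ℤ, n < 0 → fourierCoeff u n = 0

/-- The function `e^{iθ} ↦ k(e^{iθ})` of a polynomial `k`. -/
noncomputable def polyOnCircle (k : Polynomial ℂ) (x : UCircle) : ℂ :=
  k.eval (AddCircle.toCircle x : ℂ)

/-- The constraint `|u| ≤ 1` a.e. on `J`. -/
def BoundedByOneOn (J : Set UCircle) (u : UCircle → ℂ) : Prop :=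
  ∀ᵐ x ∂(circleMeasure.restrict J), ‖u x‖ ≤ 1

/-- `k` solves the polynomial bounded extremal problem of degree `n` for `f` on `I`, the constraint
being put on the complement of `I`. -/
def IsPBEPSolution (I : Set UCircle) (f : UCircle → ℂ) (n : ℕ) (k : Polynomial ℂ) : Prop :=
  k.natDegree ≤ n ∧ BoundedByOneOn Iᶜ (polyOnCircle k) ∧
    ∀ q : Polynomial ℂ, q.natDegree ≤ n → BoundedByOneOn Iᶜ (polyOnCircle q) →
      normOn 2 I (f - polyOnCircle k) ≤ normOn 2 I (f - polyOnCircle q)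

/-- `g₀` solves the analytic bounded extremal problem for `f` on `I`, the constraint being put on
the complement of `I`. -/
def IsABEPSolution (I : Set UCircle) (f g₀ : UCircle → ℂ) : Prop :=
  MemHardy 2 g₀ ∧ BoundedByOneOn Iᶜ g₀ ∧
    ∀ g : UCircle → ℂ, MemHardy 2 g → BoundedByOneOn Iᶜ g →
      normOn 2 I (f - g₀) ≤ normOn 2 I (f - g)

/-- `f` is the trace on `I` of an `H²` function of modulus at most `1` a.e. off `I`. -/
def IsAdmissibleTrace (I : Set UCircle) (f : UCircle → ℂ) : Prop :=
  ∃ g : UCircle → ℂ, MemHardy 2 g ∧ BoundedByOneOn Iᶜ g ∧ f =ᵐ[circleMeasure.restrict I] g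

/-! The basic tool is the multiplier `exp (-h)`, where `h` is in `H²` with prescribed real part `u ≥
0`. It maps `H²` to itself, multiplies moduli by `exp (-u)`, multiplies the mean by the exponential
of minus the mean of `h`, and is close to `1` when `u` is small in `L²`. Fejér means link it with
polynomials: their kernel is positive, so they preserve nonnegative real parts and almost preserve
local bounds.

Three consequences follow. An `H²` function vanishing on a set of positive measure is zero, so
polynomials are dense in `L²(E)` when the complement of `E` has positive measure. Polynomials
bounded by `1` on the closed set `J` approximate in `L²` every `H²` function with that bound. And
perturbations of `g₀` can be cut down to respect the constraint.

On `I`: by the second consequence the polynomial minima tend to the analytic minimum, and convexity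
with the parallelogram law turns this into convergence of the minimizers. On `J`: for `v = g₀ - k_n`
and a polynomial `q` with `q(0) = 0`, the integral of `vq` over the circle is zero, so its integral
over `J` is controlled by `v` on `I`. Density of such `q` in `L¹(J)` gives weak-* convergence.

If `f ≠ g₀` on `I`, then `|g₀| = 1` a.e. on `J`: slack on a set of positive measure would permit a
perturbation close to `f - g₀` on `I`, decreasing the error. Weak convergence to a unimodular limit
under `|k_n| ≤ 1` is strong, since `|g₀ - k_n|² ≤ 2 Re ((g₀ - k_n) conj g₀)`. The main steps are
`memHardy_exp_neg_mul`, `exists_polynomial_boundedByOneOn`, `tendsto_setIntegral_compl_mul_zero` and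
`re_inner_sub_smul_nonpos`. -/

/-! ### Fejér kernels and Fejér means -/

theorem fourier_eq_zpow (n : ℤ) (x : UCircle) :
    fourier n x = (AddCircle.toCircle x : ℂ) ^ n := by
  rw [fourier_apply, AddCircle.toCircle_zsmul, Circle.coe_zpow]

theorem norm_fourier_apply (n : ℤ) (x : UCircle) : ‖fourier n x‖ = 1 := by
  rw [fourier_apply, Circle.norm_coe]

theorem fourier_sub_apply (n : ℤ) (x t : UCircle) :
    fourier n (x - t) = fourier n x * fourier (-n) t := by
  rw [fourier_neg, sub_eq_add_neg]
  simp only [fourier_eq_zpow, AddCircle.toCircle_add, AddCircle.toCircle_neg, Circle.coe_mul,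
    Circle.coe_inv_eq_conj, mul_zpow, map_zpow₀]

/-- The squared modulus of a geometric sum on the unit circle, as a double sum of monomials. -/
theorem norm_sq_geom_sum_eq {z : ℂ} (hz1 : ‖z‖ = 1) (N : ℕ) :
    ((‖∑ j ∈ Finset.range N, z ^ j‖ ^ 2 : ℝ) : ℂ) =
      ∑ M ∈ Finset.range N, ∑ n ∈ Finset.Icc (-(M : ℤ)) M, z ^ n := by
  have hc : ∀ w : ℂ, ((‖w‖ ^ 2 : ℝ) : ℂ) = w * conj w := fun w => by
    rw [Complex.mul_conj, Complex.normSq_eq_norm_sq]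
  have hzz : z * conj z = 1 := by rw [← hc, hz1]; simp
  have hinv : z⁻¹ = conj z := inv_eq_of_mul_eq_one_right hzz
  have hS : ∀ (w : ℂ) (M : ℕ), ∑ j ∈ Finset.range (M + 1), w ^ j =
      w * ∑ j ∈ Finset.range M, w ^ j + 1 := by
    intro w M
    rw [Finset.sum_range_succ', Finset.mul_sum, pow_zero]
    simp only [pow_succ']
  -- The Dirichlet kernel, written so as to match the increment of the squared modulus when `z ^ M`
  -- joins the geometric sum: for `j < M` the products `z ^ M * (conj z) ^ j` run through `z, …, z ^
  -- M`.
  have hD : ∀ M : ℕ, ∑ n ∈ Finset.Icc (-(M : ℤ)) M, z ^ n =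
      z ^ M * (∑ j ∈ Finset.range M, (conj z) ^ j) +
        (conj z) ^ M * (∑ j ∈ Finset.range M, z ^ j) + 1 := by
    intro M
    induction M with
    | zero => simp
    | succ M ih =>
      push_cast
      rw [Finset.sum_Icc_succ_eq_add_endpoints (fun n => z ^ n), ih, hS, hS, zpow_neg, ← inv_zpow,
        hinv]
      have h1 : ∀ w : ℂ, w ^ ((M : ℤ) + 1) = w ^ (M + 1) := fun w => by exact_mod_cast rfl
      rw [h1, h1, pow_succ, pow_succ]
      linear_combination (-(z ^ M * ∑ j ∈ Finset.range M, (conj z) ^ j) -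
        (conj z) ^ M * ∑ j ∈ Finset.range M, z ^ j) * hzz
  induction N with
  | zero => simp
  | succ N ih =>
    rw [Finset.sum_range_succ (fun M : ℕ => ∑ n ∈ Finset.Icc (-(M : ℤ)) M, z ^ n), ← ih, hD,
      hc, hc, Finset.sum_range_succ, map_add, map_pow, map_sum]
    simp only [map_pow]
    have : z ^ N * conj z ^ N = 1 := by rw [← mul_pow, hzz, one_pow]
    linear_combination this

/-- The Fejér kernel. -/
noncomputable def fejerKernel (N : ℕ) (x : UCircle) : ℝ :=
  (N : ℝ)⁻¹ * ‖∑ j ∈ Finset.range N, (AddCircle.toCircle x : ℂ) ^ j‖ ^ 2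

/-- The Fejér mean of a function. -/
noncomputable def fejerMean (N : ℕ) (g : UCircle → ℂ) (x : UCircle) : ℂ :=
  (N : ℂ)⁻¹ * ∑ M ∈ Finset.range N, ∑ n ∈ Finset.Icc (-(M : ℤ)) M, fourierCoeff g n * fourier n x

theorem fejerKernel_nonneg (N : ℕ) (x : UCircle) : 0 ≤ fejerKernel N x := by
  unfold fejerKernel; positivity

theorem fejerKernel_eq (N : ℕ) (x : UCircle) : (fejerKernel N x : ℂ) =
    (N : ℂ)⁻¹ * ∑ M ∈ Finset.range N, ∑ n ∈ Finset.Icc (-(M : ℤ)) M, fourier n x := by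
  rw [fejerKernel, Complex.ofReal_mul, norm_sq_geom_sum_eq (Circle.norm_coe _)]
  simp only [fourier_eq_zpow]
  push_cast
  rfl

theorem continuous_fejerKernel (N : ℕ) : Continuous (fejerKernel N) := by
  unfold fejerKernel
  have := AddCircle.continuous_toCircle (T := 2 * Real.pi)
  fun_prop

theorem fejerMean_eq_integral (N : ℕ) {g : UCircle → ℂ} (hg : Integrable g circleMeasure)
    (x : UCircle) :
    fejerMean N g x = ∫ t, (fejerKernel N (x - t) : ℂ) * g t ∂circleMeasure := by
  have h1 : ∀ n : ℤ, Integrable (fun t => fourier n (x - t) * g t) circleMeasure := by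
    intro n
    refine ((hg.fourier_smul (-n)).const_mul (fourier n x)).congr (ae_of_all _ fun t => ?_)
    simp only [fourier_sub_apply, smul_eq_mul, mul_assoc]
  have h2 : ∀ n : ℤ, ∫ t, fourier n (x - t) * g t ∂circleMeasure =
      fourierCoeff g n * fourier n x := by
    intro n
    rw [fourierCoeff, mul_comm _ (fourier n x), ← integral_const_mul]
    simp only [fourier_sub_apply, smul_eq_mul, mul_assoc]
  simp only [fejerKernel_eq, mul_assoc, Finset.sum_mul]
  rw [integral_const_mul, integral_finsetSum _
    (fun M _ => integrable_finsetSum _ fun n _ => h1 n), fejerMean]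
  congr 1
  refine Finset.sum_congr rfl fun M _ => ?_
  rw [integral_finsetSum _ (fun n _ => h1 n)]
  exact Finset.sum_congr rfl fun n _ => (h2 n).symm

theorem fourierCoeff_one : fourierCoeff (fun _ : UCircle => (1 : ℂ)) = Pi.single 0 1 := by
  rw [← fourierCoeff_fourier (T := 2 * Real.pi) 0]
  congr 1
  ext x
  exact fourier_zero.symm

theorem integral_fejerKernel_sub {N : ℕ} (hN : N ≠ 0) (x : UCircle) :
    ∫ t, fejerKernel N (x - t) ∂circleMeasure = 1 := by
  have h := fejerMean_eq_integral N (integrable_const (1 : ℂ)) x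
  simp only [mul_one] at h
  rw [integral_complex_ofReal] at h
  rw [← Complex.ofReal_inj, ← h, fejerMean]
  have : ∀ M ∈ Finset.range N, ∑ n ∈ Finset.Icc (-(M : ℤ)) M,
      fourierCoeff (fun _ : UCircle => (1 : ℂ)) n * fourier n x = 1 := by
    intro M _
    rw [Finset.sum_eq_single 0]
    · rw [fourierCoeff_one, Pi.single_eq_same, fourier_zero, one_mul]
    · intro n _ hn
      rw [fourierCoeff_one, Pi.single_eq_of_ne hn, zero_mul]
    · intro h0; exact absurd (Finset.mem_Icc.2 ⟨by simp, by simp⟩) h0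
  rw [Finset.sum_congr rfl this]
  simp [hN]

theorem integrable_fejerKernel_sub_mul (N : ℕ) {g : UCircle → ℂ} (hg : Integrable g circleMeasure)
    (x : UCircle) : Integrable (fun t => (fejerKernel N (x - t) : ℂ) * g t) circleMeasure := by
  obtain ⟨C, hC⟩ := isCompact_univ.exists_bound_of_continuousOn
    (continuous_fejerKernel N).continuousOn
  refine hg.bdd_mul (c := C) ?_ (ae_of_all _ fun t => ?_)
  · have := continuous_fejerKernel N
    exact (by fun_prop : Continuous fun t => (fejerKernel N (x - t) : ℂ)).aestronglyMeasurable
  · rw [Complex.norm_real]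
    exact hC _ trivial

/-- An average with positive weights. This will make `exp (-q)` contractive when `q` is a Fejér mean
of such a function. -/
theorem re_fejerMean_nonneg (N : ℕ) {g : UCircle → ℂ} (hg : Integrable g circleMeasure)
    (h0 : ∀ᵐ x ∂circleMeasure, 0 ≤ (g x).re) (x : UCircle) : 0 ≤ (fejerMean N g x).re := by
  rw [fejerMean_eq_integral N hg, ← Complex.reCLM_apply,
    ← ContinuousLinearMap.integral_comp_comm _ (integrable_fejerKernel_sub_mul N hg x)]
  refine integral_nonneg_of_ae ?_
  filter_upwards [h0] with t ht
  simpa using mul_nonneg (fejerKernel_nonneg N _) ht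

/-- Away from the origin, the Fejér kernel is of order `1 / N`. -/
theorem fejerKernel_le {N : ℕ} {δ : ℝ} (hδ : 0 < δ) {x : UCircle}
    (hx : δ ≤ ‖(AddCircle.toCircle x : ℂ) - 1‖) : fejerKernel N x ≤ (N : ℝ)⁻¹ * (4 / δ ^ 2) := by
  unfold fejerKernel
  gcongr
  have hne : (AddCircle.toCircle x : ℂ) ≠ 1 := by
    intro h; rw [h] at hx; simp at hx; linarith
  rw [geom_sum_eq hne, norm_div, div_pow]
  gcongr
  have : ‖(AddCircle.toCircle x : ℂ) ^ N - 1‖ ≤ 2 := by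
    refine (norm_sub_le _ _).trans ?_
    rw [norm_pow, Circle.norm_coe]; norm_num
  calc _ ≤ (2 : ℝ) ^ 2 := by gcongr
    _ = 4 := by norm_num

/-- A Fejér mean is almost bounded by `1` at points near which the function is bounded by `1`. -/
theorem norm_fejerMean_le {N : ℕ} (hN : N ≠ 0) {g : UCircle → ℂ}
    (hg : Integrable g circleMeasure) {δ : ℝ} (hδ : 0 < δ) {x : UCircle}
    (h1 : ∀ᵐ t ∂circleMeasure, ‖(AddCircle.toCircle (x - t) : ℂ) - 1‖ < δ → ‖g t‖ ≤ 1) :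
    ‖fejerMean N g x‖ ≤ 1 + (N : ℝ)⁻¹ * (4 / δ ^ 2 * ∫ t, ‖g t‖ ∂circleMeasure) := by
  have hK : Integrable (fun t => fejerKernel N (x - t)) circleMeasure := by
    have := integrable_fejerKernel_sub_mul N (integrable_const (1 : ℂ)) x
    simpa using this.re
  rw [fejerMean_eq_integral N hg]
  -- The first summand dominates where `t` is near `x`, since there `‖g t‖ ≤ 1`; the second
  -- dominates elsewhere, by decay of the kernel.
  calc _ ≤ ∫ t, (fejerKernel N (x - t) + (N : ℝ)⁻¹ * (4 / δ ^ 2) * ‖g t‖) ∂circleMeasure := by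
        refine norm_integral_le_of_norm_le (hK.add (hg.norm.const_mul _)) ?_
        filter_upwards [h1] with t ht
        rw [norm_mul, Complex.norm_real, Real.norm_of_nonneg (fejerKernel_nonneg _ _)]
        have h0 := fejerKernel_nonneg N (x - t)
        by_cases hd : ‖(AddCircle.toCircle (x - t) : ℂ) - 1‖ < δ
        · have := mul_le_mul_of_nonneg_left (ht hd) h0
          have : 0 ≤ (N : ℝ)⁻¹ * (4 / δ ^ 2) * ‖g t‖ := by positivity
          linarith
        · have := mul_le_mul_of_nonneg_right (fejerKernel_le (N := N) hδ (not_lt.1 hd))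
            (norm_nonneg (g t))
          linarith
    _ = _ := by
        rw [integral_add hK (hg.norm.const_mul _), integral_fejerKernel_sub hN,
          integral_const_mul, mul_assoc]

theorem tendsto_Icc_neg_self_atTop :
    Tendsto (fun M : ℕ => Finset.Icc (-(M : ℤ)) M) atTop atTop := by
  refine tendsto_atTop_finset_of_monotone (fun a b h => ?_) fun n => ⟨n.natAbs, ?_⟩
  · exact Finset.Icc_subset_Icc (by simpa using h) (by simpa using h)
  · rw [Finset.mem_Icc]; omega

/-- Fejér means converge in `L²`. -/
theorem tendsto_eLpNorm_fejerMean_sub {g : UCircle → ℂ} (hg : MemLp g 2 circleMeasure) :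
    Tendsto (fun N => eLpNorm (fejerMean N g - g) 2 circleMeasure) atTop (𝓝 0) := by
  -- Fejér means are the Cesàro averages of the symmetric partial sums, which converge in `L²`.
  have hS := ((hasSum_fourier_series_L2 hg.toLp).comp tendsto_Icc_neg_self_atTop).cesaro_smul
  have hc : fourierCoeff (hg.toLp : UCircle → ℂ) = fourierCoeff g :=
    fourierCoeff_congr_ae hg.coeFn_toLp
  rw [hc] at hS
  rw [Lp.tendsto_Lp_iff_tendsto_eLpNorm'] at hS
  refine hS.congr fun N => eLpNorm_congr_ae ?_
  refine EventuallyEq.sub ?_ hg.coeFn_toLp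
  set F : C(UCircle, ℂ) := ((N⁻¹ : ℝ) : ℂ) • ∑ M ∈ Finset.range N,
    ∑ n ∈ Finset.Icc (-(M : ℤ)) M, fourierCoeff g n • fourier n with hF
  have h1 : ((N⁻¹ : ℝ) • ∑ M ∈ Finset.range N, ∑ n ∈ Finset.Icc (-(M : ℤ)) M,
      fourierCoeff g n • fourierLp 2 n : Lp ℂ 2 circleMeasure) =
      ContinuousMap.toLp 2 circleMeasure ℂ F := by
    rw [hF, map_smul, map_sum]
    simp only [map_sum, map_smul, fourierLp]
    rw [Complex.coe_smul]
    rfl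
  have h2 : fejerMean N g = F := by
    ext x
    simp [hF, fejerMean, -fourier_apply]
  rw [h2]
  refine EventuallyEq.trans ?_ (ContinuousMap.coeFn_toLp (p := 2) (𝕜 := ℂ) circleMeasure F)
  exact Eventually.of_forall fun x => congrArg (fun u : Lp ℂ 2 circleMeasure => u x) h1

/-- The Fejér means of a function with vanishing coefficients of negative index are polynomials. -/
theorem exists_polynomial_eq_fejerMean (N : ℕ) {g : UCircle → ℂ}
    (hg : ∀ n : ℤ, n < 0 → fourierCoeff g n = 0) :
    ∃ q : Polynomial ℂ, q.natDegree ≤ N ∧ polyOnCircle q = fejerMean N g := by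
  -- `n.toNat` is `0` for negative `n`, which is harmless because the coefficient is then zero.
  refine ⟨Polynomial.C (N : ℂ)⁻¹ * ∑ M ∈ Finset.range N, ∑ n ∈ Finset.Icc (-(M : ℤ)) M,
    Polynomial.C (fourierCoeff g n) * Polynomial.X ^ n.toNat, ?_, ?_⟩
  · refine (Polynomial.natDegree_C_mul_le _ _).trans ?_
    refine Polynomial.natDegree_sum_le_of_forall_le _ _ fun M hM =>
      Polynomial.natDegree_sum_le_of_forall_le _ _ fun n hn => ?_
    refine (Polynomial.natDegree_C_mul_X_pow_le _ _).trans ?_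
    rw [Finset.mem_Icc] at hn
    rw [Finset.mem_range] at hM
    omega
  · ext x
    rw [polyOnCircle, fejerMean]
    simp only [Polynomial.eval_mul, Polynomial.eval_finsetSum, Polynomial.eval_C,
      Polynomial.eval_pow, Polynomial.eval_X]
    congr 1
    refine Finset.sum_congr rfl fun M _ => Finset.sum_congr rfl fun n _ => ?_
    rcases lt_or_ge n 0 with h | h
    · rw [hg n h]; simp
    · rw [fourier_eq_zpow]
      lift n to ℕ using h
      simp

/-! ### Fourier coefficients of products with polynomials -/

theorem continuous_polyOnCircle (q : Polynomial ℂ) : Continuous (polyOnCircle q) := by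
  unfold polyOnCircle
  have := AddCircle.continuous_toCircle (T := 2 * Real.pi)
  fun_prop

theorem memLp_polyOnCircle (q : Polynomial ℂ) (p : ℝ≥0∞) :
    MemLp (polyOnCircle q) p circleMeasure :=
  (continuous_polyOnCircle q).memLp_of_hasCompactSupport (HasCompactSupport.of_compactSpace _)

theorem fourierCoeff_fourier_mul (k n : ℤ) (g : UCircle → ℂ) :
    fourierCoeff (fun x => fourier k x * g x) n = fourierCoeff g (n - k) := by
  simp only [fourierCoeff]
  refine integral_congr_ae (ae_of_all _ fun x => ?_)
  simp only [smul_eq_mul]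
  rw [neg_sub, sub_eq_add_neg, fourier_add]
  ring

theorem fourierCoeff_polyOnCircle_mul (q : Polynomial ℂ) {g : UCircle → ℂ}
    (hg : Integrable g circleMeasure) (n : ℤ) :
    fourierCoeff (fun x => polyOnCircle q x * g x) n =
      ∑ j ∈ Finset.range (q.natDegree + 1), q.coeff j * fourierCoeff g (n - j) := by
  have h1 : (fun x => polyOnCircle q x * g x) = ∑ j ∈ Finset.range (q.natDegree + 1),
      fun x => q.coeff j * (fourier (j : ℤ) x * g x) := by
    ext x
    rw [polyOnCircle, Polynomial.eval_eq_sum_range, Finset.sum_mul, Finset.sum_apply]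
    refine Finset.sum_congr rfl fun j _ => ?_
    rw [fourier_eq_zpow, zpow_natCast, mul_assoc]
  have h2 : ∀ j ∈ Finset.range (q.natDegree + 1), Integrable
      (fun x => q.coeff j * (fourier (j : ℤ) x * g x)) circleMeasure :=
    fun j _ => (hg.fourier_smul j).const_mul _
  rw [h1, fourierCoeff.sum _ _ h2, Finset.sum_apply]
  refine Finset.sum_congr rfl fun j _ => ?_
  rw [fourierCoeff.const_mul, fourierCoeff_fourier_mul]

theorem fourierCoeff_polyOnCircle_mul_of_neg (q : Polynomial ℂ) {g : UCircle → ℂ}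
    (hg : Integrable g circleMeasure) (h0 : ∀ n : ℤ, n < 0 → fourierCoeff g n = 0) {n : ℤ}
    (hn : n < 0) : fourierCoeff (fun x => polyOnCircle q x * g x) n = 0 := by
  rw [fourierCoeff_polyOnCircle_mul q hg]
  exact Finset.sum_eq_zero fun j _ => by rw [h0 _ (by omega), mul_zero]

theorem fourierCoeff_polyOnCircle_mul_zero (q : Polynomial ℂ) {g : UCircle → ℂ}
    (hg : Integrable g circleMeasure) (h0 : ∀ n : ℤ, n < 0 → fourierCoeff g n = 0) :
    fourierCoeff (fun x => polyOnCircle q x * g x) 0 = q.eval 0 * fourierCoeff g 0 := by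
  rw [fourierCoeff_polyOnCircle_mul q hg, Finset.sum_eq_single 0]
  · simp [Polynomial.coeff_zero_eq_eval_zero]
  · intro j _ hj
    rw [h0 _ (by omega), mul_zero]
  · simp

theorem fourierCoeff_polyOnCircle_of_neg (q : Polynomial ℂ) {n : ℤ} (hn : n < 0) :
    fourierCoeff (polyOnCircle q) n = 0 := by
  have := fourierCoeff_polyOnCircle_mul_of_neg q (integrable_const (1 : ℂ))
    (fun n hn => by rw [fourierCoeff_one, Pi.single_eq_of_ne hn.ne]) hn
  simpa using this

theorem memHardy_polyOnCircle (q : Polynomial ℂ) : MemHardy 2 (polyOnCircle q) :=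
  ⟨memLp_polyOnCircle q 2, fun _ hn => fourierCoeff_polyOnCircle_of_neg q hn⟩

theorem fourierCoeff_polyOnCircle_zero (q : Polynomial ℂ) :
    fourierCoeff (polyOnCircle q) 0 = q.eval 0 := by
  have := fourierCoeff_polyOnCircle_mul_zero q (integrable_const (1 : ℂ))
    (fun n hn => by rw [fourierCoeff_one, Pi.single_eq_of_ne hn.ne])
  rw [fourierCoeff_one, Pi.single_eq_same, mul_one] at this
  simpa using this

/-- Fourier coefficients pass to dominated limits. -/
theorem tendsto_fourierCoeff_of_dominated {F : ℕ → UCircle → ℂ} {G : UCircle → ℂ}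
    {b : UCircle → ℝ} (hF : ∀ m, AEStronglyMeasurable (F m) circleMeasure)
    (hb : Integrable b circleMeasure) (hFb : ∀ m, ∀ᵐ x ∂circleMeasure, ‖F m x‖ ≤ b x)
    (hlim : ∀ᵐ x ∂circleMeasure, Tendsto (fun m => F m x) atTop (𝓝 (G x))) (n : ℤ) :
    Tendsto (fun m => fourierCoeff (F m) n) atTop (𝓝 (fourierCoeff G n)) := by
  refine tendsto_integral_of_dominated_convergence b (fun m => ?_) hb (fun m => ?_) ?_
  · exact (map_continuous (fourier (-n))).aestronglyMeasurable.smul (hF m)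
  · filter_upwards [hFb m] with x hx
    rwa [norm_smul, norm_fourier_apply, one_mul]
  · filter_upwards [hlim] with x hx
    exact hx.const_smul _

theorem ae_eq_of_fourierCoeff_eq {f g : UCircle → ℂ} (hf : MemLp f 2 circleMeasure)
    (hg : MemLp g 2 circleMeasure) (h : ∀ n, fourierCoeff f n = fourierCoeff g n) :
    f =ᵐ[circleMeasure] g := by
  have : hf.toLp = hg.toLp := by
    apply (fourierBasis (T := 2 * Real.pi)).repr.injective
    ext n
    rw [fourierBasis_repr, fourierBasis_repr, fourierCoeff_congr_ae hf.coeFn_toLp,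
      fourierCoeff_congr_ae hg.coeFn_toLp, h]
  exact (MemLp.toLp_eq_toLp_iff hf hg).1 this

theorem fourierCoeff_conj (f : UCircle → ℂ) (n : ℤ) :
    fourierCoeff (fun x => conj (f x)) n = conj (fourierCoeff f (-n)) := by
  rw [fourierCoeff, fourierCoeff, ← integral_conj]
  refine integral_congr_ae (ae_of_all _ fun x => ?_)
  simp only [smul_eq_mul, map_mul]
  rw [← fourier_neg, neg_neg]

theorem integrable_of_memLp_two {f : UCircle → ℂ} (hf : MemLp f 2 circleMeasure) :
    Integrable f circleMeasure :=
  hf.integrable one_le_two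

/-! ### Prescribed real parts and exponential multipliers on `H²` -/

/-- Bounded Fourier multipliers act on `L²`. -/
theorem exists_fourierCoeff_eq_mul {f : UCircle → ℂ} (hf : MemLp f 2 circleMeasure) (m : ℤ → ℂ)
    {C : ℝ} (hC : 0 ≤ C) (hm : ∀ n, ‖m n‖ ≤ C) :
    ∃ h : UCircle → ℂ, MemLp h 2 circleMeasure ∧
      (∀ n, fourierCoeff h n = m n * fourierCoeff f n) ∧
      eLpNorm h 2 circleMeasure ≤ ENNReal.ofReal C * eLpNorm f 2 circleMeasure := by
  set v := (fourierBasis (T := 2 * Real.pi)).repr hf.toLp with hv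
  have hle : ∀ n, ‖m n * v n‖ ^ 2 ≤ C ^ 2 * ‖v n‖ ^ 2 := fun n => by
    rw [norm_mul, mul_pow]
    gcongr
    exact hm n
  have hvs : HasSum (fun n => ‖v n‖ ^ 2) (‖v‖ ^ 2) := by
    apply_mod_cast lp.hasSum_norm ?_ v
    simp
  have hs : Summable fun n => ‖m n * v n‖ ^ 2 :=
    Summable.of_nonneg_of_le (fun _ => by positivity) hle (hvs.summable.mul_left _)
  have hmem : Memℓp (fun n => m n * v n) 2 := by
    apply memℓp_gen
    simpa using hs
  set w : lp (fun _ : ℤ => ℂ) 2 := ⟨_, hmem⟩ with hw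
  have hws : HasSum (fun n => ‖w n‖ ^ 2) (‖w‖ ^ 2) := by
    apply_mod_cast lp.hasSum_norm ?_ w
    simp
  have hwn : ‖w‖ ≤ C * ‖v‖ := by
    refine le_of_sq_le_sq ?_ (by positivity)
    rw [mul_pow]
    exact hasSum_le hle hws (hvs.mul_left _)
  set h := (fourierBasis (T := 2 * Real.pi)).repr.symm w with hh
  refine ⟨h, Lp.memLp h, fun n => ?_, ?_⟩
  · rw [← fourierBasis_repr, hh, LinearIsometryEquiv.apply_symm_apply,
      ← fourierCoeff_congr_ae hf.coeFn_toLp, ← fourierBasis_repr]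
  · have h1 : ‖h‖ ≤ ‖(C : ℂ) • hf.toLp‖ := by
      rw [hh, LinearIsometryEquiv.norm_map, norm_smul, Complex.norm_real, Real.norm_of_nonneg hC]
      rwa [hv, LinearIsometryEquiv.norm_map] at hwn
    have h2 := (enorm_le_iff_norm_le).2 h1
    rw [enorm_smul, Lp.enorm_def, Lp.enorm_def, eLpNorm_congr_ae hf.coeFn_toLp] at h2
    refine h2.trans_eq ?_
    rw [← ofReal_norm, Complex.norm_real, Real.norm_of_nonneg hC]

/-- Every real function in `L²` is the real part of a function in `H²`. -/
theorem exists_memHardy_re_eq {u : UCircle → ℝ} (hu : MemLp u 2 circleMeasure) :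
    ∃ h : UCircle → ℂ, MemHardy 2 h ∧ (∀ᵐ x ∂circleMeasure, (h x).re = u x) ∧
      fourierCoeff h 0 = ((∫ x, u x ∂circleMeasure : ℝ) : ℂ) ∧
      eLpNorm h 2 circleMeasure ≤ 2 * eLpNorm u 2 circleMeasure := by
  have hf : MemLp (fun x => (u x : ℂ)) 2 circleMeasure := hu.ofReal
  set c := fourierCoeff fun x => (u x : ℂ) with hc
  have hcc : ∀ n, conj (c (-n)) = c n := fun n => by
    rw [hc, ← fourierCoeff_conj]
    simp only [Complex.conj_ofReal]
  -- The multiplier `0, 1, 2` on negative, zero and positive indices is that of `u` plus `i` times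
  -- its conjugate function; since `u` is real, `h + conj h` has the coefficients of `2u`.
  obtain ⟨h, hh, hcoef, hn⟩ := exists_fourierCoeff_eq_mul hf
    (fun n => if n < 0 then 0 else if n = 0 then 1 else 2) (C := 2) (by norm_num) (fun n => by
      split_ifs <;> norm_num)
  refine ⟨h, ⟨hh, fun n hn => ?_⟩, ?_, ?_, ?_⟩
  · rw [hcoef, if_pos hn, zero_mul]
  · have hstar : MemLp (fun x => conj (h x)) 2 circleMeasure := hh.star
    have key : (h + fun x => conj (h x)) =ᵐ[circleMeasure] fun x => 2 * (u x : ℂ) := by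
      refine ae_eq_of_fourierCoeff_eq (hh.add hstar) (hf.const_mul 2) fun n => ?_
      rw [fourierCoeff.add (integrable_of_memLp_two hh) (integrable_of_memLp_two hstar),
        Pi.add_apply, fourierCoeff_conj, fourierCoeff.const_mul, hcoef, hcoef, map_mul, ← hc, hcc]
      rcases lt_trichotomy n 0 with h | h | h
      · rw [if_pos h, if_neg (by omega), if_neg (by omega), zero_mul, zero_add, map_ofNat]
      · subst h
        simp only [lt_self_iff_false, if_false, if_true, neg_zero, map_one]
        ring
      · rw [if_neg (by omega), if_neg (by omega), if_pos (by omega)]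
        simp
    filter_upwards [key] with x hx
    have := congrArg Complex.re hx
    simp at this
    linarith
  · rw [hcoef, if_neg (by simp), if_pos rfl, one_mul, fourierCoeff, ← integral_complex_ofReal]
    refine integral_congr_ae (ae_of_all _ fun x => ?_)
    simp only [neg_zero, fourier_zero, one_smul]
  · refine hn.trans_eq ?_
    congr 1
    · norm_num
    · exact eLpNorm_congr_norm_ae (ae_of_all _ fun x => by simp)

/-- The Taylor polynomials of the exponential at `-q` are polynomials, for which both claims are
algebraic; they are uniformly bounded on the circle, so the coefficients pass to the limit. -/
theorem fourierCoeff_exp_neg_polyOnCircle_mul (q : Polynomial ℂ) {g : UCircle → ℂ}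
    (hg : Integrable g circleMeasure) (h0 : ∀ n : ℤ, n < 0 → fourierCoeff g n = 0) :
    (∀ n : ℤ, n < 0 →
      fourierCoeff (fun x => Complex.exp (-polyOnCircle q x) * g x) n = 0) ∧
    fourierCoeff (fun x => Complex.exp (-polyOnCircle q x) * g x) 0 =
      Complex.exp (-q.eval 0) * fourierCoeff g 0 := by
  set E : ℕ → Polynomial ℂ := fun M =>
    ∑ j ∈ Finset.range M, Polynomial.C ((j.factorial : ℂ)⁻¹) * (-q) ^ j with hE
  have heval : ∀ M w, (E M).eval w = ∑ j ∈ Finset.range M, (-q.eval w) ^ j / j.factorial := by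
    intro M w
    simp only [hE, Polynomial.eval_finsetSum, Polynomial.eval_mul, Polynomial.eval_C,
      Polynomial.eval_pow, Polynomial.eval_neg, div_eq_inv_mul]
  have hlim : ∀ w, Tendsto (fun M => (E M).eval w) atTop (𝓝 (Complex.exp (-q.eval w))) := by
    intro w
    simp only [heval]
    rw [Complex.exp_eq_exp_ℂ]
    exact (NormedSpace.expSeries_div_hasSum_exp (-q.eval w)).tendsto_sum_nat
  obtain ⟨C, hC⟩ := isCompact_univ.exists_bound_of_continuousOn
    (continuous_polyOnCircle q).continuousOn
  have hbd : ∀ M x, ‖polyOnCircle (E M) x‖ ≤ Real.exp C := by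
    intro M x
    rw [polyOnCircle, heval]
    refine (norm_sum_le _ _).trans ?_
    simp only [norm_div, norm_pow, norm_neg, Complex.norm_natCast]
    refine (Real.sum_le_exp_of_nonneg (norm_nonneg _) M).trans (Real.exp_le_exp.2 ?_)
    exact hC x trivial
  have hT := tendsto_fourierCoeff_of_dominated (F := fun M x => polyOnCircle (E M) x * g x)
    (G := fun x => Complex.exp (-polyOnCircle q x) * g x) (b := fun x => Real.exp C * ‖g x‖)
    (fun M => (continuous_polyOnCircle _).aestronglyMeasurable.mul hg.1) (hg.norm.const_mul _)
    (fun M => ae_of_all _ fun x => by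
      rw [norm_mul]; exact mul_le_mul_of_nonneg_right (hbd M x) (norm_nonneg _))
    (ae_of_all _ fun x => (hlim _).mul_const _)
  constructor
  · intro n hn
    refine tendsto_nhds_unique (hT n) ?_
    simp only [fourierCoeff_polyOnCircle_mul_of_neg _ hg h0 hn]
    exact tendsto_const_nhds
  · refine tendsto_nhds_unique (hT 0) ?_
    simp only [fourierCoeff_polyOnCircle_mul_zero _ hg h0]
    exact (hlim 0).mul_const _

theorem norm_exp_neg_le_one {w : ℂ} (hw : 0 ≤ w.re) : ‖Complex.exp (-w)‖ ≤ 1 := by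
  rw [Complex.norm_exp]
  exact Real.exp_le_one_iff.2 (by simpa using hw)

/-- Multiplying a function in `H²` by `exp (-h)`, where `h` is in `H²` with nonnegative real
part. -/
theorem memHardy_exp_neg_mul {g h : UCircle → ℂ} (hg : MemHardy 2 g) (hh : MemHardy 2 h)
    (h0 : ∀ᵐ x ∂circleMeasure, 0 ≤ (h x).re) :
    MemHardy 2 (fun x => Complex.exp (-h x) * g x) ∧
    fourierCoeff (fun x => Complex.exp (-h x) * g x) 0 =
      Complex.exp (-fourierCoeff h 0) * fourierCoeff g 0 := by
  have hgi := integrable_of_memLp_two hg.1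
  have hhi := integrable_of_memLp_two hh.1
  -- Replacing `h` by its Fejér means keeps the real part nonnegative, so all products are dominated
  -- by `‖g‖`; a subsequence converges a.e.
  choose q hqd hq using fun N => exists_polynomial_eq_fejerMean N hh.2
  have hre : ∀ N x, 0 ≤ (polyOnCircle (q N) x).re := fun N x => by
    rw [hq]; exact re_fejerMean_nonneg N hhi h0 x
  have hL2 : Tendsto (fun N => eLpNorm (polyOnCircle (q N) - h) 2 circleMeasure) atTop (𝓝 0) := by
    simp only [hq]
    exact tendsto_eLpNorm_fejerMean_sub hh.1
  have hL1 : Tendsto (fun N => eLpNorm (polyOnCircle (q N) - h) 1 circleMeasure) atTop (𝓝 0) := by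
    refine tendsto_of_tendsto_of_tendsto_of_le_of_le tendsto_const_nhds hL2 (fun _ => zero_le)
      fun N => eLpNorm_le_eLpNorm_of_exponent_le one_le_two
        ((memLp_polyOnCircle _ 2).sub hh.1).1
  have hc0 : Tendsto (fun N => (q N).eval 0) atTop (𝓝 (fourierCoeff h 0)) := by
    have := tendsto_integral_of_L1' h hhi.1
      (Eventually.of_forall fun N => (memLp_polyOnCircle (q N) 1).integrable le_rfl) hL1
    refine (this.congr fun N => ?_).trans_eq ?_
    · rw [← fourierCoeff_polyOnCircle_zero, fourierCoeff]
      simp [-fourier_apply, fourier_zero]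
    · rw [fourierCoeff]
      simp [-fourier_apply, fourier_zero]
  obtain ⟨ns, hns, hae⟩ := (tendstoInMeasure_of_tendsto_eLpNorm two_ne_zero
    (fun N => (memLp_polyOnCircle (q N) 2).1) hh.1.1 hL2).exists_seq_tendsto_ae
  have hT := tendsto_fourierCoeff_of_dominated
    (F := fun N x => Complex.exp (-polyOnCircle (q (ns N)) x) * g x)
    (G := fun x => Complex.exp (-h x) * g x) (b := fun x => ‖g x‖)
    (fun M => (Complex.continuous_exp.comp
      (continuous_polyOnCircle _).neg).aestronglyMeasurable.mul hgi.1) hgi.norm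
    (fun M => ae_of_all _ fun x => by
      rw [norm_mul]
      exact mul_le_of_le_one_left (norm_nonneg _) (norm_exp_neg_le_one (hre _ x)))
    (by
      filter_upwards [hae] with x hx
      exact (Complex.continuous_exp.continuousAt.tendsto.comp hx.neg).mul_const _)
  refine ⟨⟨?_, fun n hn => ?_⟩, ?_⟩
  · refine hg.1.mono ((Complex.continuous_exp.comp_aestronglyMeasurable hh.1.1.neg).mul hg.1.1) ?_
    filter_upwards [h0] with x hx
    rw [norm_mul]
    exact mul_le_of_le_one_left (norm_nonneg _) (norm_exp_neg_le_one hx)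
  · refine tendsto_nhds_unique (hT n) ?_
    simp only [(fourierCoeff_exp_neg_polyOnCircle_mul _ hgi hg.2).1 n hn]
    exact tendsto_const_nhds
  · refine tendsto_nhds_unique (hT 0) ?_
    simp only [(fourierCoeff_exp_neg_polyOnCircle_mul _ hgi hg.2).2]
    exact (Complex.continuous_exp.continuousAt.tendsto.comp
      ((hc0.comp hns.tendsto_atTop).neg)).mul_const _

theorem fourierCoeff_zero_eq_integral (f : UCircle → ℂ) :
    fourierCoeff f 0 = ∫ x, f x ∂circleMeasure := by
  rw [fourierCoeff]
  refine integral_congr_ae (ae_of_all _ fun x => ?_)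
  simp only [neg_zero, fourier_zero, one_smul]

theorem memHardy_const_smul {h : UCircle → ℂ} (hh : MemHardy 2 h) (c : ℂ) :
    MemHardy 2 (c • h) :=
  ⟨hh.1.const_smul c, fun n hn => by rw [fourierCoeff.const_smul, hh.2 n hn, smul_zero]⟩

theorem memHardy_add {g h : UCircle → ℂ} (hg : MemHardy 2 g) (hh : MemHardy 2 h) :
    MemHardy 2 (g + h) :=
  ⟨hg.1.add hh.1, fun n hn => by
    rw [fourierCoeff.add (integrable_of_memLp_two hg.1) (integrable_of_memLp_two hh.1),
      Pi.add_apply, hg.2 n hn, hh.2 n hn, add_zero]⟩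

/-! ### Uniqueness for functions vanishing on a set of positive measure -/

/-- The mean of an `H²` function vanishing on a set of positive measure is zero. -/
theorem fourierCoeff_zero_eq_zero_of_vanishing {w : UCircle → ℂ} (hw : MemHardy 2 w)
    {A : Set UCircle} (hA : MeasurableSet A) (hpos : circleMeasure A ≠ 0)
    (h0 : ∀ᵐ x ∂circleMeasure, x ∈ A → w x = 0) : fourierCoeff w 0 = 0 := by
  have hu : MemLp (Aᶜ.indicator fun _ => (1 : ℝ)) 2 circleMeasure :=
    memLp_indicator_const 2 hA.compl 1 (Or.inr (measure_ne_top _ _))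
  obtain ⟨h, hh, hre, hmean, -⟩ := exists_memHardy_re_eq hu
  set a : ℝ := circleMeasure.real Aᶜ with ha
  have ha1 : a < 1 := by
    rw [ha, measureReal_compl hA, probReal_univ]
    have : 0 < circleMeasure.real A := ENNReal.toReal_pos hpos (measure_ne_top _ _)
    linarith
  rw [integral_indicator_const _ hA.compl, smul_eq_mul, mul_one, ← ha] at hmean
  -- Multiplication by `exp (-n h)` scales the mean of `w` by `exp (-n a)`, but scales `|w|` by `exp
  -- (-n)` wherever `w` is nonzero. As `a < 1`, this forces the mean to vanish.
  have hbound : ∀ n : ℕ, ‖fourierCoeff w 0‖ ≤ Real.exp (a - 1) ^ n * ∫ x, ‖w x‖ ∂circleMeasure := by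
    intro n
    obtain ⟨hm, hc⟩ := memHardy_exp_neg_mul hw (memHardy_const_smul hh (n : ℂ)) (by
      filter_upwards [hre] with x hx
      simp only [Pi.smul_apply, smul_eq_mul, Complex.mul_re, Complex.natCast_re,
        Complex.natCast_im, zero_mul, sub_zero, hx]
      exact mul_nonneg n.cast_nonneg (Set.indicator_nonneg (fun _ _ => zero_le_one) x))
    rw [fourierCoeff.const_smul, hmean, fourierCoeff_zero_eq_integral] at hc
    have h1 : ‖∫ x, Complex.exp (-((n : ℂ) • h) x) * w x ∂circleMeasure‖ ≤
        ∫ x, Real.exp (-n) * ‖w x‖ ∂circleMeasure := by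
      refine norm_integral_le_of_norm_le ((integrable_of_memLp_two hw.1).norm.const_mul _) ?_
      filter_upwards [hre, h0] with x hx hx0
      by_cases hxA : x ∈ A
      · rw [hx0 hxA]; simp
      · rw [Set.indicator_of_mem (by simpa using hxA)] at hx
        rw [norm_mul, Complex.norm_exp]
        simp [hx]
    rw [hc, norm_mul, Complex.norm_exp, integral_const_mul] at h1
    have h2 : (-((n : ℂ) • (a : ℂ))).re = -(n * a) := by simp
    rw [h2] at h1
    calc ‖fourierCoeff w 0‖ = Real.exp (n * a) * (Real.exp (-(n * a)) * ‖fourierCoeff w 0‖) := by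
          rw [← mul_assoc, ← Real.exp_add]; simp
      _ ≤ Real.exp (n * a) * (Real.exp (-n) * ∫ x, ‖w x‖ ∂circleMeasure) := by gcongr
      _ = _ := by
          rw [← mul_assoc, ← Real.exp_add, ← Real.exp_nat_mul]
          ring_nf
  have hlim : Tendsto (fun n : ℕ => Real.exp (a - 1) ^ n * ∫ x, ‖w x‖ ∂circleMeasure) atTop
      (𝓝 0) := by
    simpa using (tendsto_pow_atTop_nhds_zero_of_lt_one (Real.exp_nonneg _)
      (Real.exp_lt_one_iff.2 (by linarith : a - 1 < 0))).mul_const (∫ x, ‖w x‖ ∂circleMeasure)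
  exact norm_le_zero_iff.1 (ge_of_tendsto' hlim hbound)

/-- An `H²` function vanishing on a set of positive measure is zero. -/
theorem memHardy_ae_eq_zero {w : UCircle → ℂ} (hw : MemHardy 2 w)
    {A : Set UCircle} (hA : MeasurableSet A) (hpos : circleMeasure A ≠ 0)
    (h0 : ∀ᵐ x ∂circleMeasure, x ∈ A → w x = 0) : w =ᵐ[circleMeasure] 0 := by
  have hnat : ∀ n : ℕ, fourierCoeff w n = 0 := by
    intro n
    induction n using Nat.strong_induction_on with
    | _ n ih =>
      -- Division by `z ^ n` stays in `H²` because the coefficients below `n` already vanish, and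
      -- brings coefficient `n` to the mean.
      have hshift : MemHardy 2 (fun x => fourier (-(n : ℤ)) x * w x) := by
        refine ⟨hw.1.mono ((map_continuous (fourier _)).aestronglyMeasurable.mul hw.1.1)
          (ae_of_all _ fun x => by rw [norm_mul, norm_fourier_apply, one_mul]), fun m hm => ?_⟩
        rw [fourierCoeff_fourier_mul, sub_neg_eq_add]
        rcases lt_or_ge (m + n) 0 with h | h
        · exact hw.2 _ h
        · obtain ⟨j, hj⟩ := Int.eq_ofNat_of_zero_le h
          rw [hj]
          exact ih j (by omega)
      have := fourierCoeff_zero_eq_zero_of_vanishing hshift hA hpos (by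
        filter_upwards [h0] with x hx hxA
        rw [hx hxA, mul_zero])
      rwa [fourierCoeff_fourier_mul, sub_neg_eq_add, zero_add] at this
  refine ae_eq_of_fourierCoeff_eq hw.1 MemLp.zero fun n => ?_
  rw [show fourierCoeff (0 : UCircle → ℂ) n = 0 by simp [fourierCoeff]]
  rcases lt_or_ge n 0 with h | h
  · exact hw.2 n h
  · lift n to ℕ using h
    exact hnat n

/-! ### Approximation by polynomials satisfying the constraint -/

/-- Dominated convergence in `L²`. -/
theorem tendsto_eLpNorm_two_of_dominated {μ : Measure UCircle} {F : ℕ → UCircle → ℂ}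
    {G : UCircle → ℂ} {b : UCircle → ℝ} (hF : ∀ m, AEStronglyMeasurable (F m) μ)
    (hG : AEStronglyMeasurable G μ) (hb : MemLp b 2 μ)
    (hFb : ∀ m, ∀ᵐ x ∂μ, ‖F m x - G x‖ ≤ b x)
    (hlim : ∀ᵐ x ∂μ, Tendsto (fun m => F m x) atTop (𝓝 (G x))) :
    Tendsto (fun m => eLpNorm (F m - G) 2 μ) atTop (𝓝 0) := by
  have hsq : ∀ (f : UCircle → ℂ), eLpNorm f 2 μ = (∫⁻ x, ‖f x‖ₑ ^ (2 : ℝ) ∂μ) ^ (1 / 2 : ℝ) :=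
    fun f => by rw [eLpNorm_eq_lintegral_rpow_enorm_toReal two_ne_zero ENNReal.ofNat_ne_top]; simp
  simp only [hsq]
  have hT : Tendsto (fun m => ∫⁻ x, ‖(F m - G) x‖ₑ ^ (2 : ℝ) ∂μ) atTop (𝓝 (∫⁻ _, 0 ∂μ)) := by
    refine tendsto_lintegral_of_dominated_convergence' (fun x => ‖b x‖ₑ ^ (2 : ℝ))
      (fun m => ((hF m).sub hG).enorm.pow_const _) (fun m => ?_) ?_ ?_
    · filter_upwards [hFb m] with x hx
      gcongr
      rw [enorm_le_iff_norm_le]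
      exact hx.trans (le_abs_self _)
    · have := lintegral_rpow_enorm_lt_top_of_eLpNorm_lt_top two_ne_zero ENNReal.ofNat_ne_top hb.2
      simpa using this.ne
    · filter_upwards [hlim] with x hx
      have h1 : Tendsto (fun m => F m x - G x) atTop (𝓝 0) := by
        simpa using hx.sub_const (G x)
      have h2 := (h1.enorm).ennrpow_const 2
      simpa using h2
  rw [lintegral_zero] at hT
  simpa using hT.ennrpow_const (1 / 2)

/-- If `u m ≥ 0` tends to zero in `L²`, there are `h m` in `H²` with real parts `u m`, a
subsequence of which tends to zero almost everywhere. -/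
theorem exists_memHardy_re_eq_tendsto_zero {u : ℕ → UCircle → ℝ}
    (hu : ∀ m, MemLp (u m) 2 circleMeasure)
    (hlim : Tendsto (fun m => eLpNorm (u m) 2 circleMeasure) atTop (𝓝 0)) :
    ∃ (h : ℕ → UCircle → ℂ) (ns : ℕ → ℕ), StrictMono ns ∧ (∀ m, MemHardy 2 (h m)) ∧
      (∀ m, ∀ᵐ x ∂circleMeasure, (h m x).re = u m x) ∧
      ∀ᵐ x ∂circleMeasure, Tendsto (fun m => h (ns m) x) atTop (𝓝 0) := by
  choose h hh hre _ hn using fun m => exists_memHardy_re_eq (hu m)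
  have h2 : Tendsto (fun m => eLpNorm (h m) 2 circleMeasure) atTop (𝓝 0) := by
    refine tendsto_of_tendsto_of_tendsto_of_le_of_le tendsto_const_nhds ?_ (fun _ => zero_le) hn
    simpa using ENNReal.Tendsto.const_mul (a := 2) hlim (Or.inr ENNReal.ofNat_ne_top)
  obtain ⟨ns, hns, hae⟩ := (tendstoInMeasure_of_tendsto_eLpNorm (g := (0 : UCircle → ℂ))
    two_ne_zero (fun m => (hh m).1.1) aestronglyMeasurable_zero
    (by simpa using h2)).exists_seq_tendsto_ae
  exact ⟨h, ns, hns, hh, hre, hae⟩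

/-- From `1 + s ≤ exp s`. Hence a multiplier `exp (-h)` with `Re h = |φ| / c` cuts the modulus of
`φ` down to `c`. -/
theorem exp_neg_div_mul_le {t c : ℝ} (hc : 0 < c) : Real.exp (-(t / c)) * t ≤ c := by
  have h1 := Real.add_one_le_exp (t / c)
  have h2 : t ≤ c * Real.exp (t / c) := by
    have : t = c * (t / c) := by field_simp
    nlinarith
  calc Real.exp (-(t / c)) * t ≤ Real.exp (-(t / c)) * (c * Real.exp (t / c)) := by gcongr
    _ = c * (Real.exp (-(t / c)) * Real.exp (t / c)) := by ring
    _ = c := by rw [← Real.exp_add]; simp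

/-- An `H²` function of modulus at most one on a closed set is an `L²` limit of `H²` functions of
modulus at most one near that set. -/
theorem exists_memHardy_bounded_near {J : Set UCircle} (hJ : IsClosed J) {g : UCircle → ℂ}
    (hg : MemHardy 2 g) (hgJ : BoundedByOneOn J g) {ε : ℝ≥0∞} (hε : 0 < ε) :
    ∃ (G : UCircle → ℂ) (δ : ℝ), 0 < δ ∧ MemHardy 2 G ∧
      (∀ x ∈ J, ∀ᵐ t ∂circleMeasure,
        ‖(AddCircle.toCircle (x - t) : ℂ) - 1‖ < δ → ‖G t‖ ≤ 1) ∧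
      eLpNorm (G - g) 2 circleMeasure < ε := by
  have htc : Continuous fun t : UCircle => (AddCircle.toCircle t : ℂ) :=
    continuous_subtype_val.comp AddCircle.continuous_toCircle
  set Z : Set ℂ := (fun t : UCircle => (AddCircle.toCircle t : ℂ)) '' J with hZ
  have hZc : IsClosed Z := (hJ.isCompact.image htc).isClosed
  set r : ℕ → ℝ := fun m => 1 / ((m : ℝ) + 1) with hr
  have hrpos : ∀ m, 0 < r m := fun m => by positivity
  -- Collars around `J`, without `J` itself. As `J` is closed, every point eventually leaves them,
  -- so `g` restricted to them tends to zero in `L²`.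
  set E : ℕ → Set UCircle := fun m =>
    {t | Metric.infEDist (AddCircle.toCircle t : ℂ) Z < ENNReal.ofReal (r m)} \ J with hE
  have hEm : ∀ m, MeasurableSet (E m) := fun m =>
    (measurableSet_lt (Metric.continuous_infEDist.comp htc).measurable
      measurable_const).diff hJ.measurableSet
  have hlimE : ∀ t, ∀ᶠ m in atTop, t ∉ E m := by
    intro t
    by_cases ht : t ∈ J
    · exact Eventually.of_forall fun m h => h.2 ht
    · have hpos : 0 < Metric.infEDist (AddCircle.toCircle t : ℂ) Z := by
        rw [pos_iff_ne_zero, Ne, ← Metric.mem_iff_infEDist_zero_of_closed hZc]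
        rintro ⟨s, hs, hst⟩
        have : s = t := AddCircle.injective_toCircle Real.two_pi_pos.ne' (Subtype.ext hst)
        exact ht (this ▸ hs)
      have h0 : Tendsto (fun m => ENNReal.ofReal (r m)) atTop (𝓝 0) := by
        rw [← ENNReal.ofReal_zero]
        exact ENNReal.tendsto_ofReal tendsto_one_div_add_atTop_nhds_zero_nat
      filter_upwards [h0.eventually_lt_const hpos] with m hm h
      exact lt_asymm hm h.1
  -- With `Re h = |g|` on the collar, `|exp (-h) g| = |g| exp (-|g|) ≤ 1` there, while moduli
  -- elsewhere are unchanged.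
  set u : ℕ → UCircle → ℝ := fun m => (E m).indicator fun x => ‖g x‖ with hu
  have huL : ∀ m, MemLp (u m) 2 circleMeasure := fun m => hg.1.norm.indicator (hEm m)
  have hulim : Tendsto (fun m => eLpNorm (u m) 2 circleMeasure) atTop (𝓝 0) := by
    have := tendsto_eLpNorm_two_of_dominated (μ := circleMeasure)
      (F := fun m x => (u m x : ℂ)) (G := 0) (b := fun x => ‖g x‖)
      (fun m => (huL m).ofReal.1) aestronglyMeasurable_zero hg.1.norm
      (fun m => ae_of_all _ fun x => by
        rw [Pi.zero_apply, sub_zero, Complex.norm_real, norm_indicator_eq_indicator_norm]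
        refine (Set.indicator_le_self' (fun _ _ => norm_nonneg _) x).trans ?_
        simp)
      (ae_of_all _ fun x => by
        refine tendsto_const_nhds.congr' ?_
        filter_upwards [hlimE x] with m hm
        simp [hu, hm])
    refine this.congr fun m => eLpNorm_congr_norm_ae (ae_of_all _ fun x => by simp)
  obtain ⟨h, ns, -, hh, hre, hae⟩ := exists_memHardy_re_eq_tendsto_zero huL hulim
  have hre0 : ∀ m, ∀ᵐ x ∂circleMeasure, 0 ≤ (h m x).re := fun m => by
    filter_upwards [hre m] with x hx
    rw [hx]
    exact Set.indicator_nonneg (fun _ _ => norm_nonneg _) x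
  have hG := fun m => (memHardy_exp_neg_mul hg (hh m) (hre0 m)).1
  have hT := tendsto_eLpNorm_two_of_dominated (μ := circleMeasure)
    (F := fun m x => Complex.exp (-h (ns m) x) * g x) (G := g) (b := fun x => 2 * ‖g x‖)
    (fun m => (hG _).1.1) hg.1.1 (hg.1.norm.const_mul 2)
    (fun m => by
      filter_upwards [hre0 (ns m)] with x hx
      refine (norm_sub_le _ _).trans ?_
      rw [norm_mul]
      have := mul_le_of_le_one_left (norm_nonneg (g x)) (norm_exp_neg_le_one hx)
      linarith)
    (by
      filter_upwards [hae] with x hx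
      simpa using (Complex.continuous_exp.continuousAt.tendsto.comp hx.neg).mul_const (g x))
  obtain ⟨m, hm⟩ := (hT.eventually_lt_const hε).exists
  refine ⟨_, r (ns m), hrpos _, hG (ns m), fun x hx => ?_, hm⟩
  rw [BoundedByOneOn, ae_restrict_iff' hJ.measurableSet] at hgJ
  filter_upwards [hgJ, hre (ns m), hre0 (ns m)] with t ht hret hre0t htx
  rw [norm_mul]
  by_cases htJ : t ∈ J
  · exact mul_le_one₀ (norm_exp_neg_le_one hre0t) (norm_nonneg _) (ht htJ)
  · have htE : t ∈ E (ns m) := by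
      refine ⟨?_, htJ⟩
      refine (Metric.infEDist_le_edist_of_mem (Set.mem_image_of_mem _ hx)).trans_lt ?_
      rw [edist_dist, ENNReal.ofReal_lt_ofReal_iff (hrpos _), dist_comm, dist_eq_norm]
      refine lt_of_eq_of_lt ?_ htx
      rw [sub_eq_add_neg x, AddCircle.toCircle_add, AddCircle.toCircle_neg, Circle.coe_mul,
        Circle.coe_inv, ← div_eq_mul_inv, div_sub_one (Circle.coe_ne_zero _), norm_div,
        Circle.norm_coe, div_one]
    rw [Complex.norm_exp, Complex.neg_re, hret, hu]
    simp only [Set.indicator_of_mem htE]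
    simpa using exp_neg_div_mul_le (t := ‖g t‖) one_pos

/-- Polynomials of modulus at most one on a closed set are dense, in `L²`, in the `H²` functions of
modulus at most one there. -/
theorem exists_polynomial_boundedByOneOn {J : Set UCircle} (hJ : IsClosed J) {g : UCircle → ℂ}
    (hg : MemHardy 2 g) (hgJ : BoundedByOneOn J g) {ε : ℝ≥0∞} (hε : 0 < ε) :
    ∃ q : Polynomial ℂ, BoundedByOneOn J (polyOnCircle q) ∧
      eLpNorm (polyOnCircle q - g) 2 circleMeasure < ε := by
  obtain ⟨G, δ, hδ, hG, hb, hn⟩ := exists_memHardy_bounded_near hJ hg hgJ (ENNReal.half_pos hε.ne')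
  have hGi := integrable_of_memLp_two hG.1
  choose q hqd hq using fun N => exists_polynomial_eq_fejerMean N hG.2
  set C := 4 / δ ^ 2 * ∫ t, ‖G t‖ ∂circleMeasure with hC
  have hC0 : 0 ≤ C := mul_nonneg (by positivity) (integral_nonneg fun _ => norm_nonneg _)
  -- The factor that restores the bound `1` on `J`, where the Fejér mean is bounded by `1 + C / N`.
  set s : ℕ → ℝ := fun N => (1 + (N : ℝ)⁻¹ * C)⁻¹ with hs
  have hs0 : ∀ N : ℕ, 0 < 1 + (N : ℝ)⁻¹ * C := fun N => by positivity
  have hslim : Tendsto s atTop (𝓝 1) := by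
    have h1 : Tendsto (fun N : ℕ => 1 + (N : ℝ)⁻¹ * C) atTop (𝓝 (1 + 0 * C)) :=
      (tendsto_inv_atTop_nhds_zero_nat.mul_const C).const_add 1
    simpa using h1.inv₀ (by simp)
  have hT : Tendsto (fun N => eLpNorm ((s N : ℂ) • polyOnCircle (q N) - G) 2 circleMeasure) atTop
      (𝓝 0) := by
    have hle : ∀ N, eLpNorm ((s N : ℂ) • polyOnCircle (q N) - G) 2 circleMeasure ≤
        ‖(s N : ℂ)‖ₑ * eLpNorm (fejerMean N G - G) 2 circleMeasure +
          ‖(s N : ℂ) - 1‖ₑ * eLpNorm G 2 circleMeasure := by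
      intro N
      rw [← eLpNorm_const_smul, ← eLpNorm_const_smul, ← hq]
      have : (s N : ℂ) • polyOnCircle (q N) - G =
          (s N : ℂ) • (polyOnCircle (q N) - G) + ((s N : ℂ) - 1) • G := by
        rw [smul_sub, sub_smul, one_smul]; abel
      rw [this]
      exact eLpNorm_add_le ((((memLp_polyOnCircle _ 2).sub hG.1).const_smul _).1)
        (hG.1.const_smul _).1 one_le_two
    have hsc : Tendsto (fun N => (s N : ℂ)) atTop (𝓝 1) := by
      rw [← Complex.ofReal_one]
      exact (Complex.continuous_ofReal.tendsto 1).comp hslim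
    have h1 := ENNReal.Tendsto.mul hsc.enorm (Or.inr ENNReal.zero_ne_top)
      (tendsto_eLpNorm_fejerMean_sub hG.1) (Or.inr (by simp))
    have h2 := ENNReal.Tendsto.mul_const (b := eLpNorm G 2 circleMeasure)
      (hsc.sub_const 1).enorm (Or.inr hG.1.2.ne)
    refine tendsto_of_tendsto_of_tendsto_of_le_of_le tendsto_const_nhds ?_ (fun _ => zero_le) hle
    simpa using h1.add h2
  obtain ⟨N, hNlt, hN0⟩ :=
    ((hT.eventually_lt_const (ENNReal.half_pos hε.ne')).and (eventually_ne_atTop 0)).exists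
  have hpoly : polyOnCircle (Polynomial.C (s N : ℂ) * q N) = (s N : ℂ) • polyOnCircle (q N) := by
    ext x; simp [polyOnCircle]
  refine ⟨Polynomial.C (s N : ℂ) * q N, ?_, ?_⟩
  · rw [BoundedByOneOn, ae_restrict_iff' hJ.measurableSet]
    refine ae_of_all _ fun x hx => ?_
    rw [hpoly, Pi.smul_apply, norm_smul, hq, Complex.norm_real,
      Real.norm_of_nonneg (inv_nonneg.2 (hs0 N).le), inv_mul_le_iff₀ (hs0 N), mul_one]
    exact norm_fejerMean_le hN0 hGi hδ (hb x hx)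
  · rw [hpoly, ← sub_add_sub_cancel _ G]
    refine (eLpNorm_add_le (((memLp_polyOnCircle _ 2).const_smul _).sub hG.1).1
      (hG.1.sub hg.1).1 one_le_two).trans_lt ?_
    exact (ENNReal.add_lt_add hNlt hn).trans_eq (ENNReal.add_halves ε)

/-! ### Density of polynomials and weak convergence off `I` -/

/-- The polynomials as elements of `L²(E)`. -/
noncomputable def polyLp (E : Set UCircle) :
    Polynomial ℂ →ₗ[ℂ] Lp ℂ 2 (circleMeasure.restrict E) where
  toFun q := ((memLp_polyOnCircle q 2).restrict E).toLp
  map_add' p q := by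
    rw [← MemLp.toLp_add]
    congr 1
    ext x
    simp [polyOnCircle]
  map_smul' c q := by
    rw [RingHom.id_apply, ← MemLp.toLp_const_smul]
    congr 1
    ext x
    simp [polyOnCircle]

/-- Polynomials are dense in `L²` of a set whose complement has positive measure. -/
theorem exists_polynomial_eLpNorm_sub_lt {E : Set UCircle} (hE : MeasurableSet E)
    (hpos : circleMeasure Eᶜ ≠ 0) {r : UCircle → ℂ} (hr : MemLp r 2 (circleMeasure.restrict E))
    {ε : ℝ≥0∞} (hε : 0 < ε) :
    ∃ q : Polynomial ℂ, eLpNorm (polyOnCircle q - r) 2 (circleMeasure.restrict E) < ε := by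
  have htop : (LinearMap.range (polyLp E)).topologicalClosure = ⊤ := by
    rw [Submodule.topologicalClosure_eq_top_iff, Submodule.eq_bot_iff]
    intro v hv
    set w : UCircle → ℂ := fun x => conj (E.indicator v x) with hw
    have hvL : MemLp (E.indicator v) 2 circleMeasure :=
      (memLp_indicator_iff_restrict hE).2 (Lp.memLp v)
    have hcoef : ∀ n : ℕ, fourierCoeff (E.indicator v) n = 0 := by
      intro n
      have h1 := (Submodule.mem_orthogonal _ _).1 hv (polyLp E (Polynomial.X ^ n)) ⟨_, rfl⟩
      rw [L2.inner_def] at h1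
      rw [fourierCoeff, ← h1, ← integral_indicator hE]
      refine integral_congr_ae ?_
      have h2 := (ae_restrict_iff' hE).1
        ((memLp_polyOnCircle (Polynomial.X ^ n) 2).restrict E).coeFn_toLp
      filter_upwards [h2] with x hx
      by_cases hxE : x ∈ E
      · rw [Set.indicator_of_mem hxE, Set.indicator_of_mem hxE, RCLike.inner_apply', polyLp]
        simp only [LinearMap.coe_mk, AddHom.coe_mk]
        rw [hx hxE, fourier_neg, fourier_eq_zpow, polyOnCircle]
        simp
      · rw [Set.indicator_of_notMem hxE, Set.indicator_of_notMem hxE, smul_zero]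
    -- Orthogonality to all `z ^ n` kills the coefficients of index `n ≥ 0` of the extension of `v`
    -- by zero, so its conjugate is in `H²`; it vanishes off `E`, hence everywhere.
    have hwH : MemHardy 2 w := by
      refine ⟨hvL.star, fun n hn => ?_⟩
      rw [hw, fourierCoeff_conj]
      have := hcoef (-n).toNat
      rw [Int.toNat_of_nonneg (by omega)] at this
      rw [this, map_zero]
    have hw0 := memHardy_ae_eq_zero hwH hE.compl hpos (ae_of_all _ fun x hx => by
      rw [hw]
      simp only
      rw [Set.indicator_of_notMem hx, map_zero])
    rw [Lp.eq_zero_iff_ae_eq_zero]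
    refine (ae_restrict_iff' hE).2 ?_
    filter_upwards [hw0] with x hx hxE
    simpa [hw, Set.indicator_of_mem hxE] using hx
  have hmem : hr.toLp ∈ closure (LinearMap.range (polyLp E) : Set _) := by
    rw [← Submodule.topologicalClosure_coe, htop]; trivial
  obtain ⟨_, ⟨q, rfl⟩, hq⟩ := EMetric.mem_closure_iff.1 hmem ε hε
  refine ⟨q, ?_⟩
  rw [edist_comm, polyLp] at hq
  simp only [LinearMap.coe_mk, AddHom.coe_mk] at hq
  rwa [Lp.edist_toLp_toLp] at hq

theorem eLpNorm_restrict_le_of_exponent_le {p q : ℝ≥0∞} (hpq : p ≤ q) (hp : 1 ≤ p)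
    {E : Set UCircle} {f : UCircle → ℂ}
    (hf : AEStronglyMeasurable f (circleMeasure.restrict E)) :
    eLpNorm f p (circleMeasure.restrict E) ≤ eLpNorm f q (circleMeasure.restrict E) := by
  rcases eq_or_ne p ∞ with rfl | hpt
  · rw [top_le_iff.1 hpq]
  refine (eLpNorm_le_eLpNorm_mul_rpow_measure_univ hpq hf).trans
    (mul_le_of_le_one_right zero_le (ENNReal.rpow_le_one ?_ ?_))
  · rw [Measure.restrict_apply_univ]; exact prob_le_one
  · rw [sub_nonneg]
    rcases eq_or_ne q ∞ with rfl | hqt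
    · simp
    · exact one_div_le_one_div_of_le
        (ENNReal.toReal_pos (zero_lt_one.trans_le hp).ne' hpt) (ENNReal.toReal_mono hqt hpq)

/-- Polynomials vanishing at the origin are dense in `L¹` of a set whose complement has positive
measure. -/
theorem exists_polynomial_eLpNorm_one_sub_lt {E : Set UCircle} (hE : MeasurableSet E)
    (hpos : circleMeasure Eᶜ ≠ 0) {r : UCircle → ℂ} (hr : MemLp r 1 (circleMeasure.restrict E))
    {ε : ℝ≥0∞} (hε : 0 < ε) :
    ∃ q : Polynomial ℂ, q.eval 0 = 0 ∧
      eLpNorm (r - polyOnCircle q) 1 (circleMeasure.restrict E) < ε := by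
  obtain ⟨b, hb, -⟩ := hr.exists_boundedContinuous_eLpNorm_sub_le ENNReal.one_ne_top
    (ENNReal.half_pos hε.ne').ne'
  -- Approximating `conj z * b` by `q` is the same as approximating `b` by `z q`, which vanishes at
  -- the origin.
  have hbc : Continuous fun x => fourier (-1) x * b x :=
    (map_continuous (fourier (-1))).mul b.continuous
  have hbL : ∀ p, MemLp (fun x => fourier (-1) x * b x) p (circleMeasure.restrict E) := fun p =>
    hbc.memLp_of_hasCompactSupport (HasCompactSupport.of_compactSpace _)
  obtain ⟨q, hq⟩ := exists_polynomial_eLpNorm_sub_lt hE hpos (hbL 2) (ENNReal.half_pos hε.ne')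
  refine ⟨Polynomial.X * q, by simp, ?_⟩
  have hqL := (memLp_polyOnCircle (Polynomial.X * q) 1).restrict E
  have hbL' : MemLp b 1 (circleMeasure.restrict E) :=
    b.continuous.memLp_of_hasCompactSupport (HasCompactSupport.of_compactSpace _)
  rw [← sub_add_sub_cancel _ (b : UCircle → ℂ)]
  refine (eLpNorm_add_le (hr.sub hbL').1 (hbL'.sub hqL).1 le_rfl).trans_lt ?_
  have h1 : eLpNorm ((b : UCircle → ℂ) - polyOnCircle (Polynomial.X * q)) 1
      (circleMeasure.restrict E) < ε / 2 := by
    refine lt_of_le_of_lt ?_ hq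
    rw [eLpNorm_sub_comm]
    refine le_trans (le_of_eq ?_) (eLpNorm_restrict_le_of_exponent_le one_le_two le_rfl
      (((memLp_polyOnCircle q 2).restrict E).sub (hbL 2)).1)
    refine eLpNorm_congr_norm_ae (ae_of_all _ fun x => ?_)
    have hz : (fourier 1 x : ℂ) * fourier (-1) x = 1 := by
      rw [← fourier_add, add_neg_cancel, fourier_zero]
    have hx : (polyOnCircle (Polynomial.X * q) - b) x =
        fourier 1 x * (polyOnCircle q - fun x => fourier (-1) x * b x) x := by
      simp only [Pi.sub_apply, mul_sub, ← mul_assoc, hz, one_mul]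
      simp [polyOnCircle]
    rw [hx, norm_mul, norm_fourier_apply, one_mul]
  calc _ < ε / 2 + ε / 2 := ENNReal.add_lt_add_of_le_of_lt (hr.sub hbL').2.ne hb h1
    _ = ε := ENNReal.add_halves ε

/-- Functions in `H²` bounded by two on `Iᶜ` and tending to zero in `L¹(I)` tend to zero weakly on
`Iᶜ`. -/
theorem tendsto_setIntegral_compl_mul_zero {I : Set UCircle} (hI : MeasurableSet I)
    (hpos : circleMeasure I ≠ 0) {v : ℕ → UCircle → ℂ} (hv : ∀ n, MemHardy 2 (v n))
    (hb : ∀ n, ∀ᵐ x ∂(circleMeasure.restrict Iᶜ), ‖v n x‖ ≤ 2)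
    (hlim : Tendsto (fun n => eLpNorm (v n) 1 (circleMeasure.restrict I)) atTop (𝓝 0))
    {r : UCircle → ℂ} (hr : MemLp r 1 (circleMeasure.restrict Iᶜ)) :
    Tendsto (fun n => ∫ x in Iᶜ, v n x * r x ∂circleMeasure) atTop (𝓝 0) := by
  rw [tendsto_zero_iff_enorm_tendsto_zero, ENNReal.tendsto_nhds_zero]
  intro ε hε
  have hε4 : 0 < ε / 2 / 2 := ENNReal.half_pos (ENNReal.half_pos hε.ne').ne'
  obtain ⟨q, hq0, hq⟩ := exists_polynomial_eLpNorm_one_sub_lt hI.compl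
    (by rwa [compl_compl]) hr hε4
  obtain ⟨C, hC⟩ := isCompact_univ.exists_bound_of_continuousOn
    (continuous_polyOnCircle q).continuousOn
  have hqi := (memLp_polyOnCircle q 2)
  have hvq : ∀ n, Integrable (fun x => v n x * polyOnCircle q x) circleMeasure := fun n =>
    (hv n).1.integrable_mul hqi
  -- Since `q(0) = 0`, the integral of `v n * q` over the circle vanishes, so its part on `Iᶜ` moves
  -- to `I` with a minus sign.
  have hsplit : ∀ n, ∫ x in Iᶜ, v n x * r x ∂circleMeasure =
      ∫ x in Iᶜ, v n x * (r - polyOnCircle q) x ∂circleMeasure -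
        ∫ x in I, v n x * polyOnCircle q x ∂circleMeasure := by
    intro n
    have h0 : ∫ x, v n x * polyOnCircle q x ∂circleMeasure = 0 := by
      have := fourierCoeff_polyOnCircle_mul_zero q (integrable_of_memLp_two (hv n).1) (hv n).2
      rw [hq0, zero_mul, fourierCoeff_zero_eq_integral] at this
      simpa only [mul_comm] using this
    rw [← integral_add_compl hI (hvq n)] at h0
    have hd : Integrable (fun x => v n x * (r - polyOnCircle q) x)
        (circleMeasure.restrict Iᶜ) :=
      ((hr.integrable le_rfl).sub ((hqi.restrict _).integrable one_le_two)).bdd_mul (c := 2)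
        (hv n).1.1.restrict (hb n)
    have hadd : ∫ x in Iᶜ, v n x * r x ∂circleMeasure =
        ∫ x in Iᶜ, v n x * (r - polyOnCircle q) x ∂circleMeasure +
          ∫ x in Iᶜ, v n x * polyOnCircle q x ∂circleMeasure := by
      rw [← integral_add hd (hvq n).integrableOn]
      refine integral_congr_ae (ae_of_all _ fun x => ?_)
      simp only [Pi.sub_apply]
      ring
    rw [hadd]
    linear_combination h0
  have hCt : Tendsto (fun n => ENNReal.ofReal C * eLpNorm (v n) 1 (circleMeasure.restrict I))
      atTop (𝓝 0) := by
    simpa using ENNReal.Tendsto.const_mul (a := ENNReal.ofReal C) hlim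
      (Or.inr ENNReal.ofReal_ne_top)
  filter_upwards [hCt.eventually_lt_const (ENNReal.half_pos hε.ne')] with n hn
  rw [hsplit]
  refine (enorm_sub_le).trans ?_
  rw [← ENNReal.add_halves ε]
  refine add_le_add ?_ (le_trans ?_ hn.le)
  · refine (enorm_integral_le_lintegral_enorm _).trans ?_
    calc _ ≤ ∫⁻ x in Iᶜ, 2 * ‖(r - polyOnCircle q) x‖ₑ ∂circleMeasure := by
          refine lintegral_mono_ae ?_
          filter_upwards [hb n] with x hx
          rw [enorm_mul]
          gcongr
          rw [← ofReal_norm]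
          exact ENNReal.ofReal_le_of_le_toReal (by simpa using hx)
      _ = 2 * eLpNorm (r - polyOnCircle q) 1 (circleMeasure.restrict Iᶜ) := by
          rw [lintegral_const_mul' _ _ ENNReal.ofNat_ne_top, eLpNorm_one_eq_lintegral_enorm]
      _ ≤ 2 * (ε / 2 / 2) := by gcongr
      _ = ε / 2 := ENNReal.mul_div_cancel two_ne_zero ENNReal.ofNat_ne_top
  · refine (enorm_integral_le_lintegral_enorm _).trans ?_
    rw [eLpNorm_one_eq_lintegral_enorm, ← lintegral_const_mul' _ _ ENNReal.ofReal_ne_top]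
    refine lintegral_mono fun x => ?_
    rw [enorm_mul, mul_comm]
    gcongr
    rw [← ofReal_norm]
    exact ENNReal.ofReal_le_ofReal (hC x trivial)

/-! ### Convergence of the minimizers on `I` -/

/-- If the midpoints of `a` and `b n` are not shorter than `a`, and the lengths of the `b n` tend to
that of `a`, then `b n` tends to `a`. -/
theorem tendsto_of_tendsto_norm_of_norm_le_midpoint {H : Type*} [NormedAddCommGroup H]
    [InnerProductSpace ℂ H] {a : H} {b : ℕ → H} (hm : ∀ n, ‖a‖ ≤ ‖(2⁻¹ : ℂ) • (a + b n)‖)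
    (hb : Tendsto (fun n => ‖b n‖) atTop (𝓝 ‖a‖)) : Tendsto b atTop (𝓝 a) := by
  rw [tendsto_iff_norm_sub_tendsto_zero]
  have hle : ∀ n, ‖b n - a‖ ^ 2 ≤ 2 * ‖b n‖ ^ 2 - 2 * ‖a‖ ^ 2 := by
    intro n
    have h1 := parallelogram_law_with_norm ℂ (b n) a
    have h2 : 2 * ‖a‖ ≤ ‖b n + a‖ := by
      have := hm n
      rw [norm_smul, norm_inv, Complex.norm_ofNat, add_comm] at this
      linarith
    nlinarith [norm_nonneg a]
  have hsq : Tendsto (fun n => ‖b n - a‖ ^ 2) atTop (𝓝 0) := by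
    refine tendsto_of_tendsto_of_tendsto_of_le_of_le tendsto_const_nhds ?_
      (fun _ => by positivity) hle
    have := ((hb.pow 2).const_mul 2).sub_const (2 * ‖a‖ ^ 2)
    simpa using this
  have := hsq.sqrt
  simpa [Real.sqrt_sq (norm_nonneg _)] using this

/-- The first-order condition for minimal length along a ray. -/
theorem re_inner_nonpos_of_norm_le_sub_smul {H : Type*} [NormedAddCommGroup H]
    [InnerProductSpace ℂ H] {a d : H}
    (h : ∀ᶠ s : ℝ in 𝓝[>] 0, ‖a‖ ≤ ‖a - (s : ℂ) • d‖) : (inner ℂ d a).re ≤ 0 := by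
  have hlim : Tendsto (fun s : ℝ => s * ‖d‖ ^ 2) (𝓝[>] 0) (𝓝 0) := by
    have : Tendsto (fun s : ℝ => s * ‖d‖ ^ 2) (𝓝 0) (𝓝 (0 * ‖d‖ ^ 2)) :=
      tendsto_id.mul_const _
    rw [zero_mul] at this
    exact this.mono_left nhdsWithin_le_nhds
  have key : 2 * (inner ℂ d a).re ≤ 0 := by
    refine ge_of_tendsto hlim ?_
    filter_upwards [h, self_mem_nhdsWithin] with s hs hs0
    have hs0' : (0 : ℝ) < s := hs0
    have h1 := norm_sub_sq (𝕜 := ℂ) a ((s : ℂ) • d)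
    have h2 : RCLike.re (inner ℂ a ((s : ℂ) • d)) = s * (inner ℂ d a).re := by
      rw [inner_smul_right]
      simp
      exact Or.inl (inner_re_symm (𝕜 := ℂ) a d)
    rw [h2, norm_smul, Complex.norm_real, Real.norm_of_nonneg hs0'.le] at h1
    have h3 : ‖a‖ ^ 2 ≤ ‖a - (s : ℂ) • d‖ ^ 2 := by gcongr
    -- Expansion of `‖a - s d‖²`; division by `s` and `s → 0` then remove the quadratic term.
    have h4 : s * (2 * (inner ℂ d a).re) ≤ s * (s * ‖d‖ ^ 2) := by nlinarith
    exact le_of_mul_le_mul_left h4 hs0'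
  linarith

theorem IsFiniteUnionOfOpenArcs.isOpen {I : Set UCircle} (hI : IsFiniteUnionOfOpenArcs I) :
    IsOpen I := by
  obtain ⟨s, -, -, rfl⟩ := hI
  exact isOpen_biUnion fun q _ => QuotientAddGroup.isOpenMap_coe _ isOpen_Ioo

theorem IsFiniteUnionOfOpenArcs.measure_ne_zero {I : Set UCircle}
    (hI : IsFiniteUnionOfOpenArcs I) : circleMeasure I ≠ 0 := by
  refine hI.isOpen.measure_ne_zero _ ?_
  obtain ⟨s, ⟨q, hq⟩, hlt, rfl⟩ := hI
  obtain ⟨θ, hθ⟩ := Set.nonempty_Ioo.2 (hlt q hq)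
  exact ⟨θ, Set.mem_biUnion hq ⟨θ, hθ, rfl⟩⟩

/-- Solutions of the polynomial problems converge in `L²(I)` to that of the analytic problem. -/
theorem tendsto_eLpNorm_two_sub_polyOnCircle {I : Set UCircle} (hI : IsOpen I)
    {f : UCircle → ℂ} (hf : MemLpOn 2 I f) {k : ℕ → Polynomial ℂ}
    (hk : ∀ n, IsPBEPSolution I f n (k n)) {g₀ : UCircle → ℂ} (hg₀ : IsABEPSolution I f g₀) :
    Tendsto (fun n => eLpNorm (g₀ - polyOnCircle (k n)) 2 (circleMeasure.restrict I)) atTop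
      (𝓝 0) := by
  set ν := circleMeasure.restrict I with hν
  have hg₀L : MemLp g₀ 2 ν := hg₀.1.1.restrict I
  have hqL : ∀ q, MemLp (polyOnCircle q) 2 ν := fun q => (memLp_polyOnCircle q 2).restrict I
  have ha : MemLp (f - g₀) 2 ν := hf.sub hg₀L
  have hb : ∀ n, MemLp (f - polyOnCircle (k n)) 2 ν := fun n => hf.sub (hqL _)
  -- The admissible set is convex, so the midpoint of `g₀` and `k n` competes with `g₀`.
  have hmid : ∀ n, ‖ha.toLp‖ ≤ ‖(2⁻¹ : ℂ) • (ha.toLp + (hb n).toLp)‖ := by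
    intro n
    have hadm : MemHardy 2 ((2⁻¹ : ℂ) • (g₀ + polyOnCircle (k n))) :=
      memHardy_const_smul (memHardy_add hg₀.1 (memHardy_polyOnCircle _)) _
    have hbd : BoundedByOneOn Iᶜ ((2⁻¹ : ℂ) • (g₀ + polyOnCircle (k n))) := by
      filter_upwards [hg₀.2.1, (hk n).2.1] with x hx hx'
      rw [Pi.smul_apply, norm_smul, norm_inv, Complex.norm_ofNat, Pi.add_apply]
      have := norm_add_le (g₀ x) (polyOnCircle (k n) x)
      linarith
    have := hg₀.2.2 _ hadm hbd
    rw [← MemLp.toLp_add, ← MemLp.toLp_const_smul, Lp.norm_toLp, Lp.norm_toLp]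
    refine ENNReal.toReal_mono (((ha.add (hb n)).const_smul _).2.ne) ?_
    refine this.trans_eq ?_
    rw [normOn]
    congr 1
    ext x
    simp only [Pi.sub_apply, Pi.smul_apply, Pi.add_apply, smul_eq_mul]
    ring
  have hnorm : Tendsto (fun n => ‖(hb n).toLp‖) atTop (𝓝 ‖ha.toLp‖) := by
    simp only [Lp.norm_toLp]
    refine (ENNReal.tendsto_toReal ha.2.ne).comp ?_
    refine tendsto_order.2 ⟨fun c hc => Eventually.of_forall fun n => hc.trans_le ?_,
      fun c hc => ?_⟩
    · exact hg₀.2.2 _ (memHardy_polyOnCircle _) (hk n).2.1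
    -- A fixed admissible polynomial near `g₀` competes with `k n` as soon as `n` reaches its
    -- degree.
    · obtain ⟨q, hqJ, hq⟩ := exists_polynomial_boundedByOneOn hI.isClosed_compl hg₀.1 hg₀.2.1
        (tsub_pos_of_lt hc)
      filter_upwards [eventually_ge_atTop q.natDegree] with n hn
      refine ((hk n).2.2 q hn hqJ).trans_lt ?_
      rw [normOn, ← sub_add_sub_cancel _ g₀]
      refine (eLpNorm_add_le ha.1 (hg₀L.sub (hqL q)).1 one_le_two).trans_lt ?_
      rw [eLpNorm_sub_comm g₀]
      have h1 : eLpNorm (polyOnCircle q - g₀) 2 ν < c - eLpNorm (f - g₀) 2 ν :=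
        (eLpNorm_mono_measure _ Measure.restrict_le_self).trans_lt hq
      have := ENNReal.add_lt_add_left ha.2.ne h1
      rwa [add_tsub_cancel_of_le hc.le] at this
  have hlim := tendsto_of_tendsto_norm_of_norm_le_midpoint hmid hnorm
  rw [Lp.tendsto_Lp_iff_tendsto_eLpNorm''] at hlim
  refine hlim.congr fun n => ?_
  congr 1
  abel

/-! ### Saturation of the constraint when `f ≠ g₀` on `I` -/

/-- The solution of the analytic problem satisfies the first-order condition for perturbations
approximating `f - g₀` on `I`, provided its modulus is at most `1 - ε` on a set of positive
measure off `I`. -/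
theorem re_inner_sub_smul_nonpos {I : Set UCircle} (hI : MeasurableSet I) {f g₀ : UCircle → ℂ}
    (hg₀ : IsABEPSolution I f g₀) {E : Set UCircle} (hE : MeasurableSet E) (hEI : E ⊆ Iᶜ)
    (hpos : circleMeasure E ≠ 0) {ε : ℝ} (hε : 0 < ε)
    (hbE : ∀ᵐ x ∂circleMeasure, x ∈ E → ‖g₀ x‖ ≤ 1 - ε)
    (ha : MemLp (f - g₀) 2 (circleMeasure.restrict I))
    (hgL : MemLp g₀ 2 (circleMeasure.restrict I)) {c : ℝ} (hc : 0 < c) :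
    (inner ℂ (ha.toLp - (c : ℂ) • hgL.toLp) ha.toLp).re ≤ 0 := by
  set ν := circleMeasure.restrict I with hν
  -- The target is `f - g₀` on `I` and `0` on `Iᶜ \ E`. Polynomials approximate it on `Eᶜ`, with no
  -- control on `E`, where the slack `ε` will absorb them.
  set r : UCircle → ℂ := I.indicator (f - g₀) with hr
  have hrL : MemLp r 2 circleMeasure := (memLp_indicator_iff_restrict hI).2 ha
  have hIE : I ⊆ Eᶜ := fun x hx hxE => hEI hxE hx
  choose φ hφ using fun m : ℕ => exists_polynomial_eLpNorm_sub_lt hE.compl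
    (by rwa [compl_compl]) (hrL.restrict Eᶜ) (ε := ((m : ℝ≥0∞) + 1)⁻¹) (by simp)
  have hφlim : Tendsto (fun m => eLpNorm (polyOnCircle (φ m) - r) 2 (circleMeasure.restrict Eᶜ))
      atTop (𝓝 0) := by
    refine tendsto_of_tendsto_of_tendsto_of_le_of_le tendsto_const_nhds ?_ (fun _ => zero_le)
      (fun m => (hφ m).le)
    have := (tendsto_add_atTop_iff_nat 1).2 ENNReal.tendsto_inv_nat_nhds_zero
    simpa using this
  set D : Set UCircle := Iᶜ \ E with hD
  have hDm : MeasurableSet D := hI.compl.diff hE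
  set u : ℕ → UCircle → ℝ := fun m => D.indicator fun x => ‖polyOnCircle (φ m) x‖ / c with hu
  have huL : ∀ m, MemLp (u m) 2 circleMeasure := fun m => by
    refine MemLp.indicator hDm ?_
    simpa only [div_eq_mul_inv] using (memLp_polyOnCircle (φ m) 2).norm.mul_const c⁻¹
  have hulim : Tendsto (fun m => eLpNorm (u m) 2 circleMeasure) atTop (𝓝 0) := by
    have hle : ∀ m, eLpNorm (u m) 2 circleMeasure ≤
        ENNReal.ofReal c⁻¹ * eLpNorm (polyOnCircle (φ m) - r) 2 (circleMeasure.restrict Eᶜ) := by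
      intro m
      rw [hu, eLpNorm_indicator_eq_eLpNorm_restrict hDm]
      refine le_trans ?_ (mul_le_mul_right (eLpNorm_mono_measure _
        (Measure.restrict_mono (show D ⊆ Eᶜ from fun x hx => hx.2) le_rfl)) _)
      refine eLpNorm_le_mul_eLpNorm_of_ae_le_mul ?_ 2
      refine (ae_restrict_iff' hDm).2 (ae_of_all _ fun x hx => ?_)
      rw [Pi.sub_apply, hr, Set.indicator_of_notMem hx.1, sub_zero, norm_div, norm_norm,
        Real.norm_of_nonneg hc.le, div_eq_inv_mul]
    refine tendsto_of_tendsto_of_tendsto_of_le_of_le tendsto_const_nhds ?_ (fun _ => zero_le) hle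
    simpa using ENNReal.Tendsto.const_mul (a := ENNReal.ofReal c⁻¹) hφlim
      (Or.inr ENNReal.ofReal_ne_top)
  obtain ⟨h, ns, hns, hh, hre, hae⟩ := exists_memHardy_re_eq_tendsto_zero huL hulim
  have hre0 : ∀ m, ∀ᵐ x ∂circleMeasure, 0 ≤ (h m x).re := fun m => by
    filter_upwards [hre m] with x hx
    rw [hx]
    exact Set.indicator_nonneg (fun _ _ => by positivity) x
  set W : ℕ → UCircle → ℂ := fun m x => Complex.exp (-h (ns m) x) * polyOnCircle (φ (ns m)) x
    with hW
  have hWH : ∀ m, MemHardy 2 (W m) := fun m =>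
    (memHardy_exp_neg_mul (memHardy_polyOnCircle _) (hh _) (hre0 _)).1
  have hWν : ∀ m, MemLp (W m) 2 ν := fun m => (hWH m).1.restrict I
  -- the perturbations converge to `f - g₀` on `I`
  have hWlim : Tendsto (fun m => eLpNorm (W m - (f - g₀)) 2 ν) atTop (𝓝 0) := by
    have hexpm : ∀ m, AEStronglyMeasurable (fun x => Complex.exp (-h (ns m) x)) ν := fun m =>
      (Complex.continuous_exp.comp_aestronglyMeasurable (hh (ns m)).1.1.neg).restrict
    have h1 : Tendsto (fun m => eLpNorm ((fun x => Complex.exp (-h (ns m) x) * (f - g₀) x) -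
        (f - g₀)) 2 ν) atTop (𝓝 0) := by
      refine tendsto_eLpNorm_two_of_dominated (b := fun x => 2 * ‖(f - g₀) x‖)
        (fun m => (hexpm m).mul ha.1) ha.1 (ha.norm.const_mul 2) (fun m => ?_) ?_
      · filter_upwards [ae_restrict_of_ae (hre0 (ns m))] with x hx
        refine (norm_sub_le _ _).trans ?_
        rw [norm_mul]
        have := mul_le_of_le_one_left (norm_nonneg ((f - g₀) x)) (norm_exp_neg_le_one hx)
        linarith
      · filter_upwards [ae_restrict_of_ae hae] with x hx
        simpa using
          (Complex.continuous_exp.continuousAt.tendsto.comp hx.neg).mul_const ((f - g₀) x)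
    refine tendsto_of_tendsto_of_tendsto_of_le_of_le tendsto_const_nhds ?_ (fun _ => zero_le)
      (h := fun m => eLpNorm (polyOnCircle (φ (ns m)) - r) 2 (circleMeasure.restrict Eᶜ) +
        eLpNorm ((fun x => Complex.exp (-h (ns m) x) * (f - g₀) x) - (f - g₀)) 2 ν) fun m => ?_
    · simpa using (hφlim.comp hns.tendsto_atTop).add h1
    · have hsum : W m - (f - g₀) =
          (fun x => Complex.exp (-h (ns m) x) * (polyOnCircle (φ (ns m)) - (f - g₀)) x) +
          ((fun x => Complex.exp (-h (ns m) x) * (f - g₀) x) - (f - g₀)) := by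
        ext x
        simp only [hW, Pi.sub_apply, Pi.add_apply]
        ring
      have hφν : MemLp (polyOnCircle (φ (ns m))) 2 ν := (memLp_polyOnCircle _ 2).restrict I
      rw [hsum]
      refine (eLpNorm_add_le ((hexpm m).mul (hφν.sub ha).1)
        (((hexpm m).mul ha.1).sub ha.1) one_le_two).trans (add_le_add_left ?_ _)
      refine le_trans ?_ (eLpNorm_mono_measure _ (Measure.restrict_mono hIE le_rfl))
      refine eLpNorm_mono_ae ?_
      filter_upwards [ae_restrict_of_ae (hre0 (ns m)), ae_restrict_mem hI] with x hx hxI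
      rw [Pi.mul_apply, norm_mul, Pi.sub_apply (polyOnCircle _) r, hr, Set.indicator_of_mem hxI]
      exact mul_le_of_le_one_left (norm_nonneg _) (norm_exp_neg_le_one hx)
  -- each perturbation satisfies the first-order condition
  have hfirst : ∀ m, (inner ℂ ((hWν m).toLp - (c : ℂ) • hgL.toLp) ha.toLp).re ≤ 0 := by
    intro m
    obtain ⟨M, hM⟩ := isCompact_univ.exists_bound_of_continuousOn
      (continuous_polyOnCircle (φ (ns m))).continuousOn
    refine re_inner_nonpos_of_norm_le_sub_smul ?_
    have e1 : ∀ᶠ s : ℝ in 𝓝[>] 0, s * c < 1 := by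
      have : Tendsto (fun s : ℝ => s * c) (𝓝 0) (𝓝 (0 * c)) := tendsto_id.mul_const _
      rw [zero_mul] at this
      exact (this.mono_left nhdsWithin_le_nhds).eventually_lt_const one_pos
    have e2 : ∀ᶠ s : ℝ in 𝓝[>] 0, s * M < ε := by
      have : Tendsto (fun s : ℝ => s * M) (𝓝 0) (𝓝 (0 * M)) := tendsto_id.mul_const _
      rw [zero_mul] at this
      exact (this.mono_left nhdsWithin_le_nhds).eventually_lt_const hε
    filter_upwards [e1, e2, self_mem_nhdsWithin] with s hs1 hs2 hs0
    have hs0' : (0 : ℝ) < s := hs0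
    have hadm : MemHardy 2 (((1 - s * c : ℝ) : ℂ) • g₀ + (s : ℂ) • W m) :=
      memHardy_add (memHardy_const_smul hg₀.1 _) (memHardy_const_smul (hWH m) _)
    -- On `D` the bound is `(1 - s c) + s c = 1`, the shrinking of `g₀` making room for `W m`; on
    -- `E` it is at most `(1 - ε) + s M < 1`.
    have hbd : BoundedByOneOn Iᶜ (((1 - s * c : ℝ) : ℂ) • g₀ + (s : ℂ) • W m) := by
      have hJ := hg₀.2.1
      rw [BoundedByOneOn, ae_restrict_iff' hI.compl] at hJ ⊢
      filter_upwards [hJ, hbE, hre (ns m), hre0 (ns m)] with x hxJ hxE hxre hxre0 hxI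
      rw [Pi.add_apply, Pi.smul_apply, Pi.smul_apply]
      refine (norm_add_le _ _).trans ?_
      rw [norm_smul, norm_smul, Complex.norm_real, Complex.norm_real,
        Real.norm_of_nonneg hs0'.le, Real.norm_of_nonneg (by linarith)]
      have h1 := hxJ hxI
      by_cases hx : x ∈ E
      · have h2 := hxE hx
        have h3 : ‖W m x‖ ≤ M := by
          rw [hW, norm_mul]
          exact (mul_le_of_le_one_left (norm_nonneg _) (norm_exp_neg_le_one hxre0)).trans
            (hM x trivial)
        have h4 : s * ‖W m x‖ ≤ s * M := by gcongr
        have h5 : (1 - s * c) * ‖g₀ x‖ ≤ ‖g₀ x‖ :=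
          mul_le_of_le_one_left (norm_nonneg _) (by nlinarith)
        linarith
      · have h3 : ‖W m x‖ ≤ c := by
          rw [hW, norm_mul, Complex.norm_exp, Complex.neg_re, hxre, hu]
          simp only
          rw [Set.indicator_of_mem (show x ∈ D from ⟨hxI, hx⟩)]
          exact exp_neg_div_mul_le hc
        have h4 : s * ‖W m x‖ ≤ s * c := by gcongr
        have h5 : (1 - s * c) * ‖g₀ x‖ ≤ 1 - s * c :=
          mul_le_of_le_one_right (by linarith) h1
        linarith
    have hmin := hg₀.2.2 _ hadm hbd
    rw [← MemLp.toLp_const_smul, ← MemLp.toLp_sub, ← MemLp.toLp_const_smul, ← MemLp.toLp_sub,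
      Lp.norm_toLp, Lp.norm_toLp]
    refine ENNReal.toReal_mono
      (ha.sub (((hWν m).sub (hgL.const_smul (c : ℂ))).const_smul (s : ℂ))).2.ne ?_
    refine hmin.trans_eq ?_
    rw [normOn]
    congr 1
    ext x
    simp only [Pi.sub_apply, Pi.smul_apply, Pi.add_apply, smul_eq_mul]
    push_cast
    ring
  have hLp : Tendsto (fun m => (hWν m).toLp) atTop (𝓝 ha.toLp) :=
    (Lp.tendsto_Lp_iff_tendsto_eLpNorm'' _ hWν _ ha).2 hWlim
  have hin : Tendsto (fun m => (inner ℂ ((hWν m).toLp - (c : ℂ) • hgL.toLp) ha.toLp).re) atTop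
      (𝓝 (inner ℂ (ha.toLp - (c : ℂ) • hgL.toLp) ha.toLp).re) :=
    (Complex.continuous_re.tendsto _).comp ((hLp.sub_const _).inner tendsto_const_nhds)
  exact le_of_tendsto' hin hfirst

/-- Otherwise the first-order condition reads `‖f - g₀‖² ≤ c Re ⟨g₀, f - g₀⟩` in `L²(I)` for every
`c > 0`, and `c → 0` gives `f = g₀` on `I`. -/
theorem measure_eq_zero_of_norm_le {I : Set UCircle} (hI : MeasurableSet I) {f g₀ : UCircle → ℂ}
    (hf : MemLpOn 2 I f) (hg₀ : IsABEPSolution I f g₀)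
    (hne : ¬ f =ᵐ[circleMeasure.restrict I] g₀) {E : Set UCircle} (hE : MeasurableSet E)
    (hEI : E ⊆ Iᶜ) {ε : ℝ} (hε : 0 < ε) (hbE : ∀ᵐ x ∂circleMeasure, x ∈ E → ‖g₀ x‖ ≤ 1 - ε) :
    circleMeasure E = 0 := by
  by_contra hpos
  have hgL : MemLp g₀ 2 (circleMeasure.restrict I) := hg₀.1.1.restrict I
  have ha : MemLp (f - g₀) 2 (circleMeasure.restrict I) := hf.sub hgL
  have hle : ∀ c : ℝ, 0 < c → ‖ha.toLp‖ ^ 2 ≤ c * (inner ℂ hgL.toLp ha.toLp).re := by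
    intro c hc
    have := re_inner_sub_smul_nonpos hI hg₀ hE hEI hpos hε hbE ha hgL hc
    rw [inner_sub_left, inner_smul_left, inner_self_eq_norm_sq_to_K, Complex.conj_ofReal,
      Complex.sub_re, Complex.re_ofReal_mul] at this
    have h2 : (((‖ha.toLp‖ : ℂ)) ^ 2).re = ‖ha.toLp‖ ^ 2 := by
      rw [← Complex.ofReal_pow, Complex.ofReal_re]
    have h3 := h2.symm.trans_le (sub_nonpos.1 this)
    exact h3
  have hlim : Tendsto (fun c : ℝ => c * (inner ℂ hgL.toLp ha.toLp).re) (𝓝[>] 0) (𝓝 0) := by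
    have : Tendsto (fun c : ℝ => c * (inner ℂ hgL.toLp ha.toLp).re) (𝓝 0)
        (𝓝 (0 * (inner ℂ hgL.toLp ha.toLp).re)) := tendsto_id.mul_const _
    rw [zero_mul] at this
    exact this.mono_left nhdsWithin_le_nhds
  have h0 : ‖ha.toLp‖ ^ 2 ≤ 0 :=
    ge_of_tendsto hlim (by filter_upwards [self_mem_nhdsWithin] with c hc using hle c hc)
  have h1 : ha.toLp = 0 := by
    rw [← norm_eq_zero]
    exact pow_eq_zero_iff two_ne_zero |>.1 (le_antisymm h0 (by positivity))
  have h2 := (Lp.eq_zero_iff_ae_eq_zero.1 h1)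
  apply hne
  filter_upwards [h2, ha.coeFn_toLp] with x hx hx'
  rw [hx'] at hx
  exact sub_eq_zero.1 hx

/-- If `f ≠ g₀` on `I`, the constraint is saturated. -/
theorem norm_eq_one_of_not_ae_eq {I : Set UCircle} (hI : MeasurableSet I) {f g₀ : UCircle → ℂ}
    (hf : MemLpOn 2 I f) (hg₀ : IsABEPSolution I f g₀)
    (hne : ¬ f =ᵐ[circleMeasure.restrict I] g₀) :
    ∀ᵐ x ∂(circleMeasure.restrict Iᶜ), ‖g₀ x‖ = 1 := by
  have hgm := hg₀.1.1.1
  -- A strongly measurable representative of `g₀` makes these sublevel sets measurable; they exhaust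
  -- the points where its modulus is below `1`.
  have hnull : ∀ n : ℕ, circleMeasure
      (Iᶜ ∩ {x | ‖hgm.mk g₀ x‖ ≤ 1 - 1 / ((n : ℝ) + 1)}) = 0 := by
    intro n
    refine measure_eq_zero_of_norm_le hI hf hg₀ hne (hI.compl.inter
      (measurableSet_le hgm.stronglyMeasurable_mk.norm.measurable measurable_const))
      Set.inter_subset_left (ε := 1 / ((n : ℝ) + 1)) (by positivity) ?_
    filter_upwards [hgm.ae_eq_mk] with x hx hxE
    rw [hx]
    exact hxE.2
  have hnull' := fun n => measure_eq_zero_iff_ae_notMem.1 (hnull n)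
  have hb := hg₀.2.1
  rw [BoundedByOneOn, ae_restrict_iff' hI.compl] at hb
  rw [ae_restrict_iff' hI.compl]
  filter_upwards [hb, ae_all_iff.2 hnull', hgm.ae_eq_mk] with x hx hxn hxm hxI
  refine le_antisymm (hx hxI) (not_lt.1 fun hlt => ?_)
  obtain ⟨n, hn⟩ := exists_nat_one_div_lt (sub_pos.2 hlt)
  refine hxn n ⟨hxI, ?_⟩
  rw [Set.mem_ofPred_eq, ← hxm]
  linarith

/-! ### From `L²` to `L^p`, and the theorem -/

/-- For functions bounded by two, convergence in `L²` implies convergence in all `L^p`, `p < ∞`. -/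
theorem tendsto_eLpNorm_of_tendsto_eLpNorm_two {E : Set UCircle} {v : ℕ → UCircle → ℂ}
    (hv : ∀ n, AEStronglyMeasurable (v n) (circleMeasure.restrict E))
    (hb : ∀ n, ∀ᵐ x ∂(circleMeasure.restrict E), ‖v n x‖ ≤ 2)
    (hlim : Tendsto (fun n => eLpNorm (v n) 2 (circleMeasure.restrict E)) atTop (𝓝 0))
    {p : ℝ≥0∞} (hp1 : 1 ≤ p) (hp : p < ∞) :
    Tendsto (fun n => eLpNorm (v n) p (circleMeasure.restrict E)) atTop (𝓝 0) := by
  rcases le_total p 2 with h2 | h2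
  · exact tendsto_of_tendsto_of_tendsto_of_le_of_le tendsto_const_nhds hlim (fun _ => zero_le)
      fun n => eLpNorm_restrict_le_of_exponent_le h2 hp1 (hv n)
  have hp0 : p ≠ 0 := (zero_lt_one.trans_le hp1).ne'
  have hpr : 2 ≤ p.toReal := by
    simpa using ENNReal.toReal_mono hp.ne h2
  set ν := circleMeasure.restrict E
  have hsq : Tendsto (fun n => ∫⁻ x, ‖v n x‖ₑ ^ (2 : ℝ) ∂ν) atTop (𝓝 0) := by
    have := hlim.ennrpow_const 2
    rw [ENNReal.zero_rpow_of_pos zero_lt_two] at this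
    refine this.congr fun n => ?_
    rw [eLpNorm_eq_lintegral_rpow_enorm_toReal two_ne_zero ENNReal.ofNat_ne_top,
      ENNReal.toReal_ofNat, ← ENNReal.rpow_mul, one_div, inv_mul_cancel₀ two_ne_zero,
      ENNReal.rpow_one]
  have hpow : Tendsto (fun n => ∫⁻ x, ‖v n x‖ₑ ^ p.toReal ∂ν) atTop (𝓝 0) := by
    -- For `p ≥ 2`, the bound by two gives `|v|^p ≤ 2^(p-2) |v|²`.
    have hC : ((2 : ℝ≥0∞) ^ (p.toReal - 2)) ≠ ∞ :=
      ENNReal.rpow_ne_top_of_nonneg (by linarith) ENNReal.ofNat_ne_top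
    refine tendsto_of_tendsto_of_tendsto_of_le_of_le tendsto_const_nhds
      (h := fun n => (2 : ℝ≥0∞) ^ (p.toReal - 2) * ∫⁻ x, ‖v n x‖ₑ ^ (2 : ℝ) ∂ν) ?_
      (fun _ => zero_le) fun n => ?_
    · simpa using ENNReal.Tendsto.const_mul hsq (Or.inr hC)
    · simp only
      rw [← lintegral_const_mul' _ _ hC]
      refine lintegral_mono_ae ?_
      filter_upwards [hb n] with x hx
      have h3 : ‖v n x‖ₑ ≤ 2 := by
        rw [← ofReal_norm]
        exact ENNReal.ofReal_le_of_le_toReal (by simpa using hx)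
      calc ‖v n x‖ₑ ^ p.toReal = ‖v n x‖ₑ ^ (p.toReal - 2) * ‖v n x‖ₑ ^ (2 : ℝ) := by
            rw [← ENNReal.rpow_add_of_nonneg _ _ (by linarith) (by norm_num)]
            congr 1
            ring
        _ ≤ _ := by gcongr
  simp only [eLpNorm_eq_lintegral_rpow_enorm_toReal hp0 hp.ne]
  have := hpow.ennrpow_const (1 / p.toReal)
  rwa [ENNReal.zero_rpow_of_pos (by positivity)] at this

theorem theorem3 (I : Set UCircle) (hI : IsFiniteUnionOfOpenArcs I)
    (hJ : (interior Iᶜ).Nonempty)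
    (f : UCircle → ℂ) (hf : MemLpOn 2 I f)
    (k : ℕ → Polynomial ℂ) (hk : ∀ n, IsPBEPSolution I f n (k n))
    (g₀ : UCircle → ℂ) (hg₀ : IsABEPSolution I f g₀) :
    -- convergence in `L^p(I)`, `1 ≤ p ≤ 2`, in particular in `L²(I)`
    (∀ p : ℝ≥0∞, 1 ≤ p → p ≤ 2 →
      Tendsto (fun n => normOn p I (g₀ - polyOnCircle (k n))) atTop (𝓝 0)) ∧
    -- weak-* convergence in `L^∞(J)`
    (∀ h : UCircle → ℂ, MemLpOn 1 Iᶜ h →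
      Tendsto (fun n => pairingOn Iᶜ (polyOnCircle (k n)) h) atTop (𝓝 (pairingOn Iᶜ g₀ h))) ∧
    -- `f` is not an admissible trace exactly when `f ≠ g₀` on `I`
    (¬ IsAdmissibleTrace I f ↔ ¬ f =ᵐ[circleMeasure.restrict I] g₀) ∧
    -- in that case, norm convergence in `L^p(J)`, `1 ≤ p < ∞`, and in `L^p` of the whole circle,
    -- `1 ≤ p ≤ 2`
    (¬ IsAdmissibleTrace I f →
      (∀ p : ℝ≥0∞, 1 ≤ p → p < ∞ →
        Tendsto (fun n => normOn p Iᶜ (g₀ - polyOnCircle (k n))) atTop (𝓝 0)) ∧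
      (∀ p : ℝ≥0∞, 1 ≤ p → p ≤ 2 →
        Tendsto (fun n => normOn p Set.univ (g₀ - polyOnCircle (k n))) atTop (𝓝 0))) := by
  have hIm : MeasurableSet I := hI.isOpen.measurableSet
  set v : ℕ → UCircle → ℂ := fun n => g₀ - polyOnCircle (k n) with hv
  have hvH : ∀ n, MemHardy 2 (v n) := fun n => by
    have := memHardy_add hg₀.1 (memHardy_const_smul (memHardy_polyOnCircle (k n)) (-1))
    rwa [neg_one_smul, ← sub_eq_add_neg] at this
  have hvb : ∀ n, ∀ᵐ x ∂(circleMeasure.restrict Iᶜ), ‖v n x‖ ≤ 2 := fun n => by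
    filter_upwards [hg₀.2.1, (hk n).2.1] with x hx hx'
    exact (norm_sub_le _ _).trans (by linarith)
  have hI2 : Tendsto (fun n => eLpNorm (v n) 2 (circleMeasure.restrict I)) atTop (𝓝 0) :=
    tendsto_eLpNorm_two_sub_polyOnCircle hI.isOpen hf hk hg₀
  have hIp : ∀ p : ℝ≥0∞, 1 ≤ p → p ≤ 2 →
      Tendsto (fun n => eLpNorm (v n) p (circleMeasure.restrict I)) atTop (𝓝 0) := by
    intro p hp1 hp2
    exact tendsto_of_tendsto_of_tendsto_of_le_of_le tendsto_const_nhds hI2 (fun _ => zero_le)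
      fun n => eLpNorm_restrict_le_of_exponent_le hp2 hp1 (hvH n).1.1.restrict
  have hweak : ∀ h : UCircle → ℂ, MemLp h 1 (circleMeasure.restrict Iᶜ) →
      Tendsto (fun n => ∫ x in Iᶜ, v n x * conj (h x) ∂circleMeasure) atTop (𝓝 0) :=
    fun h hh => tendsto_setIntegral_compl_mul_zero hIm hI.measure_ne_zero hvH hvb
      (hIp 1 le_rfl one_le_two) hh.star
  have htrace : ¬ IsAdmissibleTrace I f ↔ ¬ f =ᵐ[circleMeasure.restrict I] g₀ := by
    rw [not_iff_not]
    refine ⟨?_, fun h => ⟨g₀, hg₀.1, hg₀.2.1, h⟩⟩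
    rintro ⟨g, hg, hgJ, hfg⟩
    have h1 := hg₀.2.2 g hg hgJ
    have h2 : normOn 2 I (f - g) = 0 := by
      rw [normOn, eLpNorm_eq_zero_iff (hf.sub (hg.1.restrict I)).1 two_ne_zero]
      filter_upwards [hfg] with x hx
      simp [hx]
    rw [h2, nonpos_iff_eq_zero, normOn,
      eLpNorm_eq_zero_iff (hf.sub (hg₀.1.1.restrict I)).1 two_ne_zero] at h1
    filter_upwards [h1] with x hx
    exact sub_eq_zero.1 hx
  refine ⟨hIp, fun h hh => ?_, htrace, fun hna => ?_⟩
  · have hint : ∀ w : UCircle → ℂ, MemHardy 2 w → BoundedByOneOn Iᶜ w →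
        Integrable (fun x => w x * conj (h x)) (circleMeasure.restrict Iᶜ) := fun w hw hwb =>
      (MemLp.integrable le_rfl hh.star).bdd_mul hw.1.1.restrict hwb
    have h1 := (hweak h hh).const_sub (pairingOn Iᶜ g₀ h)
    rw [sub_zero] at h1
    refine h1.congr fun n => ?_
    rw [pairingOn, pairingOn, ← integral_sub (hint _ hg₀.1 hg₀.2.1) (((hint _ hg₀.1 hg₀.2.1).sub
      (hint _ (memHardy_polyOnCircle _) (hk n).2.1)).congr (ae_of_all _ fun x => by
        simp only [hv, Pi.sub_apply, sub_mul]))]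
    refine integral_congr_ae (ae_of_all _ fun x => ?_)
    simp only [hv, Pi.sub_apply]
    ring
  · have hone := norm_eq_one_of_not_ae_eq hIm hf hg₀ (htrace.1 hna)
    have hg1 : MemLp g₀ 1 (circleMeasure.restrict Iᶜ) :=
      (hg₀.1.1.restrict Iᶜ).mono_exponent one_le_two
    have hJ2 : Tendsto (fun n => eLpNorm (v n) 2 (circleMeasure.restrict Iᶜ)) atTop (𝓝 0) := by
      -- Weak convergence tested against `g₀` itself.
      have hre : Tendsto (fun n => 2 * (∫ x in Iᶜ, v n x * conj (g₀ x) ∂circleMeasure).re) atTop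
          (𝓝 0) := by
        simpa using ((Complex.continuous_re.tendsto _).comp (hweak g₀ hg1)).const_mul 2
      have hsqi : ∀ n, Integrable (fun x => ‖v n x‖ ^ 2) (circleMeasure.restrict Iᶜ) := fun n =>
        MemLp.integrable_norm_pow ((hvH n).1.restrict Iᶜ) two_ne_zero
      -- Pointwise, `|g₀ - k|² = 1 - 2 Re (k conj g₀) + |k|² ≤ 2 - 2 Re (k conj g₀)`, which is `2 Re
      -- ((g₀ - k) conj g₀)` because `|g₀| = 1`.
      have hle : ∀ n, ∫ x in Iᶜ, ‖v n x‖ ^ 2 ∂circleMeasure ≤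
          2 * (∫ x in Iᶜ, v n x * conj (g₀ x) ∂circleMeasure).re := by
        intro n
        have hint : Integrable (fun x => v n x * conj (g₀ x)) (circleMeasure.restrict Iᶜ) :=
          (MemLp.integrable le_rfl hg1.star).bdd_mul (hvH n).1.1.restrict (hvb n)
        rw [← Complex.reCLM_apply, ← ContinuousLinearMap.integral_comp_comm _ hint,
          ← integral_const_mul]
        refine integral_mono_ae (hsqi n)
          ((Complex.reCLM.integrable_comp hint).const_mul 2) ?_
        filter_upwards [hone, (hk n).2.1] with x hx hx'
        have e1 := Complex.sq_norm (v n x)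
        have e2 := Complex.sq_norm (g₀ x)
        have e3 := Complex.sq_norm (polyOnCircle (k n) x)
        have e4 : ‖polyOnCircle (k n) x‖ ^ 2 ≤ 1 := pow_le_one₀ (norm_nonneg _) hx'
        rw [hx] at e2
        rw [e3] at e4
        simp only [Complex.reCLM_apply, Complex.mul_re, Complex.conj_re, Complex.conj_im]
        rw [e1]
        simp only [hv, Pi.sub_apply, Complex.normSq_apply, Complex.sub_re, Complex.sub_im] at *
        nlinarith
      have hlim : Tendsto (fun n => ∫ x in Iᶜ, ‖v n x‖ ^ 2 ∂circleMeasure) atTop (𝓝 0) :=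
        tendsto_of_tendsto_of_tendsto_of_le_of_le tendsto_const_nhds hre
          (fun n => integral_nonneg fun x => by positivity) hle
      have := (ENNReal.tendsto_ofReal hlim).ennrpow_const (1 / 2)
      simp only [ENNReal.ofReal_zero] at this
      rw [ENNReal.zero_rpow_of_pos (by norm_num)] at this
      refine this.congr fun n => ?_
      rw [eLpNorm_eq_lintegral_rpow_enorm_toReal two_ne_zero ENNReal.ofNat_ne_top,
        ENNReal.toReal_ofNat, ofReal_integral_eq_lintegral_ofReal
          (hsqi n) (ae_of_all _ fun x => by positivity)]
      congr 1
      refine lintegral_congr fun x => ?_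
      rw [← ofReal_norm, ENNReal.ofReal_rpow_of_nonneg (norm_nonneg _) zero_le_two,
        Real.rpow_two]
    have hJp : ∀ p : ℝ≥0∞, 1 ≤ p → p < ∞ →
        Tendsto (fun n => eLpNorm (v n) p (circleMeasure.restrict Iᶜ)) atTop (𝓝 0) :=
      fun p hp1 hp => tendsto_eLpNorm_of_tendsto_eLpNorm_two
        (fun n => (hvH n).1.1.restrict) hvb hJ2 hp1 hp
    refine ⟨hJp, fun p hp1 hp2 => ?_⟩
    have hsum := (hIp p hp1 hp2).add (hJp p hp1 (hp2.trans_lt ENNReal.ofNat_lt_top))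
    rw [add_zero] at hsum
    refine tendsto_of_tendsto_of_tendsto_of_le_of_le tendsto_const_nhds hsum (fun _ => zero_le)
      fun n => ?_
    change eLpNorm (v n) p (circleMeasure.restrict Set.univ) ≤ _
    rw [Measure.restrict_univ, ← eLpNorm_indicator_eq_eLpNorm_restrict hIm,
      ← eLpNorm_indicator_eq_eLpNorm_restrict hIm.compl]
    conv_lhs => rw [← Set.indicator_self_add_compl I (v n)]
    exact eLpNorm_add_le ((hvH n).1.1.indicator hIm) ((hvH n).1.1.indicator hIm.compl) hp1
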